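/- **Theorem (connection matrix).** Let $q\in\mathbb C$ with $0<|q|<1$. Write $(a;q)_n=\prod_{k=0}^{n-1}(1-aq^k)$, $(a;q)_\infty=\prod_{k\ge 0}(1-aq^k)$, $(a_1,\dots,a_r;q)_n=\prod_i (a_i;q)_n$ (also for $n=\infty$), $\theta(x)=\sum_{n\in\mathbb Z}q^{n(n-1)/2}x^n$, $[c;q]=\{cq^k:k\in\mathbb Z\}$, and $$ {}_r\varphi_s(a_1,\dots,a_r;b_1,\dots,b_s;q,x)=\sum_{n\ge0}\frac{(a_1,\dots,a_r;q)_n}{(b_1,\dots,b_s;q)_n(q;q)_n}\left[(-1)^nq^{n(n-1)/2}\right]^{1+s-r}x^n .$$ A convergent ${}_2\varphi_1$ denotes also its meromorphic continuation in $x$ to $\mathbb C$. Let $a,b,\lambda,\mu\in\mathbb C^*$ with $a/b\notin[1;q]$ and $\lambda\notin[-1;q]$. Put $$ S_\mu(a,b;q,x)=\frac{\theta(a\mu x)}{\theta(\mu x)}\,{}_2\varphi_1\!\left(a,0;\tfrac{aq}{b};q,\tfrac{q}{abx}\right),$$ $$ C_\mu^\lambda(a,b;q,x)=\frac{(b;q)_\infty}{(b/a;q)_\infty}\frac{\theta(a\lambda)}{\theta(\lambda)}\frac{\theta(qax/\lambda)}{\theta(qx/\lambda)}\frac{\theta(\mu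 x)}{\theta(a\mu x)},\qquad C_\mu(a,b;q,x)=\frac{(q/a;q)_\infty}{(b/a,q;q)_\infty}\frac{\theta(-aqx)}{\theta(-qx)}\frac{\theta(\mu x)}{\theta(a\mu x)},$$ $$ {}_2f_1(a,b;q,x)=\frac{(abx;q)_\infty}{\theta(-qx)}\,{}_2\varphi_1\!\left(\tfrac qa,\tfrac qb;0;q,abx\right)$$ (a meromorphic function of $x\in\mathbb C^*$; its apparent singularities at $abx\in\{q^{-n}:n\ge 0\}$ are removed). Let ${}_2f_0$ be the $q$-Borel–Laplace resummation of the first kind of the (in general divergent) series ${}_2\varphi_0(a,b;-;q,x)=\sum_{n\ge 0} a_nx^n$: $$ {}_2f_0(a,b;\lambda,q,x)=\sum_{n\in\mathbb Z}\frac{\varphi(q^n\lambda)}{\theta(q^n\lambda/x)},\qquad \varphi(\xi)=\sum_{n\ge0}a_nq^{n(n-1)/2}\xi^n ,$$ where $\varphi$ denotes also the meromorphic continuation of this sum to $\mathbb C$. Then: 1. The meromorphic continuations to $\mathbb C$ used above exist, namely those of $\varphi(\xi)$, ${}_2\varphi_1(\tfrac qa,\tfrac qb;0;q,z)$, ${}_2\varphi_1(a,0;\tfrac{aq}b;q,z)$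 and ${}_2\varphi_1(b,0;\tfrac{bq}a;q,z)$. 2. The four functions $C_\mu^\lambda(a,b;q,x)$, $C_\mu^\lambda(b,a;q,x)$, $C_\mu(a,b;q,x)$, $C_\mu(b,a;q,x)$ are $q$-elliptic: meromorphic in $x\in\mathbb C^*$ and invariant under $x\mapsto qx$. 3. For every $x\in\mathbb C^*\setminus([1;q]\cup[-\lambda;q])$ the sum defining ${}_2f_0(a,b;\lambda,q,x)$ converges absolutely, and $$\begin{pmatrix}{}_2f_0(a,b;\lambda,q,x)\\ {}_2f_1(a,b;q,x)\end{pmatrix}=\begin{pmatrix}C_\mu^\lambda(a,b;q,x)&C_\mu^\lambda(b,a;q,x)\\ C_\mu(a,b;q,x)&C_\mu(b,a;q,x)\end{pmatrix}\begin{pmatrix}S_\mu(a,b;q,x)\\ S_\mu(b,a;q,x)\end{pmatrix}.$$ This holds pointwise if moreover $x\notin[-\tfrac1\mu;q]\cup[-\tfrac1{a\mu};q]\cup[-\tfrac1{b\mu};q]$ and $x\ne q^{n+1}/(ab)$ for all integers $n\ge 0$. At every $x\in\mathbb C^*\setminus([1;q]\cup[-\lambda;q])$, including the points just excluded (where individual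 factors on the right may be undefined), the right side at $y$ tends to the left side at $x$ as $y\to x$, $y\neq x$. -/

import Mathlib

open Filter Topology

noncomputable section

namespace QConfluent

/-- The finite `q`-shifted factorial `(a;q)_n = (1-a)(1-aq)⋯(1-aq^(n-1))`. -/
def qPoch (a q : ℂ) (n : ℕ) : ℂ := ∏ k ∈ Finset.range n, (1 - a * q ^ k)

/-- The infinite `q`-shifted factorial `(a;q)_∞`. -/
def qPochInf (a q : ℂ) : ℂ := ∏' k : ℕ, (1 - a * q ^ k)

/-- Jacobi's theta function `θ_q(x) = ∑_{n ∈ ℤ} q^(n(n-1)/2) x^n`. -/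
def theta (q x : ℂ) : ℂ := ∑' n : ℤ, q ^ (n * (n - 1) / 2) * x ^ n

/-- The `q`-spiral `[c;q] = {c q^k : k ∈ ℤ}`. -/
def spiral (c q : ℂ) : Set ℂ := Set.range fun k : ℤ => c * q ^ k

/-- The basic hypergeometric series `_rφ_s(as; bs; q, x)` as a formal power series in `x`. -/
def basicHyp (as bs : List ℂ) (q : ℂ) : PowerSeries ℂ :=
  PowerSeries.mk fun n =>
    (as.map fun a => qPoch a q n).prod / ((bs.map fun b => qPoch b q n).prod * qPoch q q n) *
      ((-1) ^ n * q ^ (n * (n - 1) / 2)) ^ (1 + (bs.length : ℤ) - (as.length : ℤ))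

/-- `F` is the meromorphic continuation to `ℂ` of the sum of the power series `f`: it is
meromorphic on `ℂ`, with removable singularities removed (and the value `0` at poles), and near
the origin the series converges to it. -/
def IsMeroCont (f : PowerSeries ℂ) (F : ℂ → ℂ) : Prop :=
  MeromorphicNFOn F Set.univ ∧
    ∀ᶠ z in 𝓝 (0 : ℂ), HasSum (fun n : ℕ => PowerSeries.coeff n f * z ^ n) (F z)

/-- The meromorphic continuation is unique. -/
theorem IsMeroCont.unique {f : PowerSeries ℂ} {F G : ℂ → ℂ} (hF : IsMeroCont f F)
    (hG : IsMeroCont f G) : F = G := by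
  have hm : MeromorphicOn (F - G) Set.univ := fun z hz =>
    (hF.1 hz).meromorphicAt.sub (hG.1 hz).meromorphicAt
  have h0 : meromorphicOrderAt (F - G) 0 = ⊤ := by
    rw [meromorphicOrderAt_eq_top_iff]
    refine Filter.Eventually.filter_mono nhdsWithin_le_nhds ?_
    filter_upwards [hF.2, hG.2] with z h1 h2
    simp [h1.unique h2]
  funext z
  have hz : meromorphicOrderAt (F - G) z = ⊤ := by
    by_contra h
    exact hm.meromorphicOrderAt_ne_top_of_isPreconnected isPreconnected_univ
      (Set.mem_univ z) (Set.mem_univ 0) h h0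
  rw [meromorphicOrderAt_eq_top_iff] at hz
  have hz' : F =ᶠ[𝓝[≠] z] G := by
    filter_upwards [hz] with w hw
    exact sub_eq_zero.1 hw
  exact (((hF.1 (Set.mem_univ z)).eventuallyEq_nhdsNE_iff_eventuallyEq_nhds
    (hG.1 (Set.mem_univ z))).1 hz').eq_of_nhds

open Classical in
/-- The meromorphic continuation to `ℂ` of the sum of a power series (`0` if there is none). -/
def meroCont (f : PowerSeries ℂ) : ℂ → ℂ :=
  if h : ∃ F, IsMeroCont f F then h.choose else 0

/-- The function `₂φ₁(a, b; c; q, x)`, meromorphically continued from `|x| < 1` to `x ∈ ℂ`. -/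
def phi21 (a b c q x : ℂ) : ℂ := meroCont (basicHyp [a, b] [c] q) x

/-- The `q`-Borel transformation of the first kind, on formal power series. -/
def qBorel (q : ℂ) (f : PowerSeries ℂ) : PowerSeries ℂ :=
  PowerSeries.mk fun n => PowerSeries.coeff n f * q ^ (n * (n - 1) / 2)

/-- The `q`-Laplace transformation of the first kind. -/
def qLaplace (q l : ℂ) (φ : ℂ → ℂ) (x : ℂ) : ℂ :=
  ∑' n : ℤ, φ (q ^ n * l) / theta q (q ^ n * l / x)

/-- `₂f₀(a, b; l, q, x)`: the `q`-Borel-Laplace resummation of the formal series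
`₂φ₀(a, b; -; q, x)`; the Laplace transformation is applied to the (continued) sum of the Borel
transform. -/
def f20 (a b l q x : ℂ) : ℂ := qLaplace q l (meroCont (qBorel q (basicHyp [a, b] [] q))) x

/-- `₂f₁(a, b; q, x) = (abx;q)_∞ / θ(-qx) · ₂φ₁(q/a, q/b; 0; q, abx)` as a meromorphic function
of `x ∈ ℂ*`: the poles of `₂φ₁` are cancelled by the zeros of `(abx;q)_∞`, and the normal form
gives the function its limit values there. -/
def f21 (a b q : ℂ) : ℂ → ℂ :=
  toMeromorphicNFOn
    (fun x => qPochInf (a * b * x) q / theta q (-q * x) * phi21 (q / a) (q / b) 0 q (a * b * x))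
    {0}ᶜ

/-- `S_m(a, b; q, x)`. -/
def solInf (m a b q x : ℂ) : ℂ :=
  theta q (a * m * x) / theta q (m * x) * phi21 a 0 (a * q / b) q (q / (a * b * x))

/-- `C_m^l(a, b; q, x)`. -/
def coeffOne (l m a b q x : ℂ) : ℂ :=
  qPochInf b q / qPochInf (b / a) q * (theta q (a * l) / theta q l) *
    (theta q (q * a * x / l) / theta q (q * x / l)) * (theta q (m * x) / theta q (a * m * x))

/-- `C_m(a, b; q, x)`. -/
def coeffTwo (m a b q x : ℂ) : ℂ :=
  qPochInf (q / a) q / (qPochInf (b / a) q * qPochInf q q) *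
    (theta q (-a * q * x) / theta q (-q * x)) * (theta q (m * x) / theta q (a * m * x))

/-- The connection matrix. -/
def connMatrix (l m a b q x : ℂ) : Matrix (Fin 2) (Fin 2) ℂ :=
  !![coeffOne l m a b q x, coeffOne l m b a q x;
     coeffTwo m a b q x, coeffTwo m b a q x]

/-- `q`-elliptic functions: meromorphic on `ℂ*` and invariant under `x ↦ q x`. -/
def IsQElliptic (q : ℂ) (f : ℂ → ℂ) : Prop :=
  MeromorphicOn f {0}ᶜ ∧ ∀ x, x ≠ 0 → f (q * x) = f x

end QConfluent

end

/-!
Both rows of the connection matrix come from one formula for the solution at the origin,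
`θ(-z) ₂φ₁(A, B; 0; q, z) = halfConn A B q z + halfConn B A q z`, where `halfConn A B q z` is a
constant times `θ(-Az) ₁φ₁(A; Aq/B; q, q²/(Bz))` (`theta_mul_phiZero`, `mul_phiEntire`).

The coefficient of `zⁿ` in `₂φ₁(A, B; 0; q, z)` is, up to a constant, the value at `t = qⁿ` of
`(qt;q)_∞ / ((At;q)_∞ (Bt;q)_∞)`, which vanishes for `n < 0`. This quotient is the sum of its
partial fractions in `t` (`qPochInf_div_eq_tsum`, a limit of Lagrange interpolation), with poles on
the two families `1/(Aqᵏ)` and `1/(Bqᵏ)`. Summed over `n ∈ ℤ` against `zⁿ` for `|q| < |z| < 1`, each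
family gives a `₁φ₁` times a bilateral sum `∑ zʲ/(1 - Aqʲ)`, which Kronecker's identity
(`theta_mul_kronecker`) evaluates by theta functions. The formula also shows that
`(z;q)_∞ ₂φ₁(A, B; 0; q, z)` extends to an entire function (`phiEntire`), because its other side is
holomorphic on `ℂ*`.

The functions at infinity have a similar form: `(z;q)_∞ ₂φ₁(a, 0; c; q, z) = ₁φ₁(c/a; c; q, az)`
(`hasSum_basicHyp_conf`), so that they too have continuations. The second row is then the formula
with `A = q/a`, `B = q/b`, `z = abx` (`f21_connection`).

For the first row, the Borel transform is `₂φ₁(a, b; 0; q, -ξ)`. On the spiral `ξ = qⁿl` the formula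
splits it into two terms (`borelValue_eq`). Since `θ(qⁿl/x)` is `θ(l/x)` up to an explicit monomial,
`θ(l/x) ₂f₀` is a Laurent series in `1/x`. When `|q/(abx)| < 1` each of its two parts is an
absolutely convergent double series that factors into a theta function and a
`₂φ₁(a, 0; aq/b; q, q/(abx))` (`hasSum_borelHalf`), and the identity theorem extends the
result to `ℂ*` (`laplaceSeries_eq`).

Both left-hand functions are continuous off `[1;q] ∪ [-l;q]`, and the right-hand side is defined in
a punctured neighbourhood of every point, so the pointwise formula there gives the limit statement.
-/

namespace QConfluent

/-! ### Gaussian weights and finite products -/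

/-- The Gaussian weight `q^(n(n-1)/2)`. -/
noncomputable def gauss (q : ℂ) (n : ℤ) : ℂ := q ^ (n * (n - 1) / 2)

lemma gauss_zero (q : ℂ) : gauss q 0 = 1 := by simp [gauss]

lemma gauss_ne_zero {q : ℂ} (hq : q ≠ 0) (n : ℤ) : gauss q n ≠ 0 := zpow_ne_zero _ hq

lemma gauss_add {q : ℂ} (hq : q ≠ 0) (m n : ℤ) :
    gauss q (m + n) = gauss q m * gauss q n * q ^ (m * n) := by
  have h : (m + n) * (m + n - 1) / 2 = m * (m - 1) / 2 + n * (n - 1) / 2 + m * n := by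
    obtain ⟨r, hr⟩ := Int.even_mul_pred_self m
    obtain ⟨s, hs⟩ := Int.even_mul_pred_self n
    have : (m + n) * (m + n - 1) = m * (m - 1) + n * (n - 1) + 2 * (m * n) := by ring
    omega
  rw [gauss, h, zpow_add₀ hq, zpow_add₀ hq, gauss, gauss]

lemma gauss_succ {q : ℂ} (hq : q ≠ 0) (n : ℤ) : gauss q (n + 1) = gauss q n * q ^ n := by
  rw [gauss_add hq]; simp [gauss]

lemma gauss_neg {q : ℂ} (hq : q ≠ 0) (n : ℤ) : gauss q (-n) = gauss q n * q ^ n := by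
  have h : (-n) * (-n - 1) / 2 = n * (n - 1) / 2 + n := by
    obtain ⟨r, hr⟩ := Int.even_mul_pred_self n
    have : (-n) * (-n - 1) = n * (n - 1) + 2 * n := by ring
    omega
  rw [gauss, h, zpow_add₀ hq, gauss]

lemma summable_gauss_nat {q : ℂ} (hq : q ≠ 0) (hq1 : ‖q‖ < 1) (x : ℂ) :
    Summable fun n : ℕ => ‖gauss q n * x ^ n‖ := by
  refine summable_of_ratio_norm_eventually_le (r := 1 / 2) (by norm_num) ?_
  have h : Tendsto (fun n : ℕ => ‖q‖ ^ n * ‖x‖) atTop (𝓝 (0 * ‖x‖)) :=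
    (tendsto_pow_atTop_nhds_zero_of_lt_one (norm_nonneg _) hq1).mul_const _
  rw [zero_mul] at h
  filter_upwards [h.eventually_le_const (show (0 : ℝ) < 1 / 2 by norm_num)] with n hn
  have : gauss q ((n + 1 : ℕ) : ℤ) * x ^ (n + 1) = (q ^ n * x) * (gauss q n * x ^ n) := by
    push_cast; rw [gauss_succ hq, zpow_natCast]; ring
  rw [this, norm_mul (q ^ n * x), norm_mul (q ^ n) x, norm_pow, Real.norm_of_nonneg (by positivity),
    Real.norm_of_nonneg (by positivity)]
  exact mul_le_mul_of_nonneg_right hn (norm_nonneg _)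

lemma summable_gauss_int {q : ℂ} (hq : q ≠ 0) (hq1 : ‖q‖ < 1) {x : ℂ} (hx : x ≠ 0) :
    Summable fun n : ℤ => ‖gauss q n * x ^ n‖ := by
  refine Summable.of_nat_of_neg ?_ ?_
  · simpa using summable_gauss_nat hq hq1 x
  · refine (summable_gauss_nat hq hq1 (q / x)).congr fun n => ?_
    rw [gauss_neg hq, zpow_neg, zpow_natCast, zpow_natCast, div_pow]
    congr 1; field_simp

lemma qPoch_zero (a q : ℂ) : qPoch a q 0 = 1 := by simp [qPoch]

lemma qPoch_zero_left (q : ℂ) (n : ℕ) : qPoch 0 q n = 1 := by simp [qPoch]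

lemma qPoch_succ (a q : ℂ) (n : ℕ) : qPoch a q (n + 1) = qPoch a q n * (1 - a * q ^ n) := by
  simp [qPoch, Finset.prod_range_succ]

lemma qPoch_add (a q : ℂ) (m n : ℕ) :
    qPoch a q (m + n) = qPoch a q m * qPoch (a * q ^ m) q n := by
  simp only [qPoch, Finset.prod_range_add, pow_add, mul_assoc]

lemma summable_norm_mul_pow {q : ℂ} (hq1 : ‖q‖ < 1) (a : ℂ) :
    Summable fun k : ℕ => ‖-(a * q ^ k)‖ := by
  simp only [norm_neg, norm_mul, norm_pow]
  exact (summable_geometric_of_lt_one (norm_nonneg _) hq1).mul_left _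

/-- A bound for the finite `q`-shifted factorials that is uniform in their length. -/
lemma norm_qPoch_le {q : ℂ} (hq1 : ‖q‖ < 1) (a : ℂ) (n : ℕ) :
    ‖qPoch a q n‖ ≤ Real.exp (‖a‖ / (1 - ‖q‖)) := by
  have h1 : ‖qPoch a q n‖ ≤ ∏ k ∈ Finset.range n, Real.exp (‖a‖ * ‖q‖ ^ k) := by
    rw [qPoch, norm_prod]
    refine Finset.prod_le_prod (fun _ _ => norm_nonneg _) fun k _ => ?_
    refine (norm_sub_le _ _).trans ?_
    rw [norm_one, norm_mul, norm_pow, add_comm]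
    exact Real.add_one_le_exp _
  refine h1.trans ?_
  rw [← Real.exp_sum, Real.exp_le_exp, div_eq_mul_inv,
    ← tsum_geometric_of_lt_one (norm_nonneg _) hq1, ← Finset.mul_sum]
  exact mul_le_mul_of_nonneg_left
    ((summable_geometric_of_lt_one (norm_nonneg _) hq1).sum_le_tsum _ fun _ _ => by positivity)
    (norm_nonneg _)

/-! ### Infinite products -/

lemma tendsto_qPoch {q : ℂ} (hq1 : ‖q‖ < 1) (a : ℂ) :
    Tendsto (qPoch a q) atTop (𝓝 (qPochInf a q)) := by
  have := (multipliable_one_add_of_summable (summable_norm_mul_pow hq1 a)).hasProd.tendsto_prod_nat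
  simp only [← sub_eq_add_neg] at this
  exact this

lemma qPochInf_eq_mul {q : ℂ} (hq1 : ‖q‖ < 1) (a : ℂ) (n : ℕ) :
    qPochInf a q = qPoch a q n * qPochInf (a * q ^ n) q := by
  refine tendsto_nhds_unique ((tendsto_add_atTop_iff_nat n).2 (tendsto_qPoch hq1 a)) ?_
  refine ((tendsto_qPoch hq1 (a * q ^ n)).const_mul (qPoch a q n)).congr fun k => ?_
  rw [add_comm, qPoch_add]

lemma qPochInf_eq_one_sub_mul {q : ℂ} (hq1 : ‖q‖ < 1) (a : ℂ) :
    qPochInf a q = (1 - a) * qPochInf (a * q) q := by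
  simpa [qPoch] using qPochInf_eq_mul hq1 a 1

lemma norm_qPochInf_le {q : ℂ} (hq1 : ‖q‖ < 1) (a : ℂ) :
    ‖qPochInf a q‖ ≤ Real.exp (‖a‖ / (1 - ‖q‖)) :=
  le_of_tendsto (tendsto_qPoch hq1 a).norm (Eventually.of_forall (norm_qPoch_le hq1 a))

lemma qPochInf_eq_zero_iff {q : ℂ} (hq1 : ‖q‖ < 1) (a : ℂ) :
    qPochInf a q = 0 ↔ ∃ k : ℕ, a * q ^ k = 1 := by
  constructor
  · intro h
    by_contra! hk
    refine tprod_one_add_ne_zero_of_summable (f := fun k : ℕ => -(a * q ^ k)) (fun k hk' => hk k ?_)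
      (summable_norm_mul_pow hq1 a) (by simp only [← sub_eq_add_neg]; exact h)
    rw [← sub_eq_add_neg, sub_eq_zero] at hk'
    exact hk'.symm
  · rintro ⟨k, hk⟩
    rw [qPochInf_eq_mul hq1 a (k + 1), qPoch_succ, hk]
    simp

lemma qPochInf_ne_zero_of_norm_lt {q : ℂ} (hq1 : ‖q‖ < 1) {a : ℂ} (ha : ‖a‖ < 1) :
    qPochInf a q ≠ 0 := by
  rw [Ne, qPochInf_eq_zero_iff hq1]
  rintro ⟨k, hk⟩
  have h : ‖a * q ^ k‖ < 1 := by
    rw [norm_mul, norm_pow]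
    exact mul_lt_one_of_nonneg_of_lt_one_left (norm_nonneg _) ha
      (pow_le_one₀ (norm_nonneg _) hq1.le)
  simp [hk] at h

lemma qPoch_ne_zero {q : ℂ} (hq1 : ‖q‖ < 1) {a : ℂ} (ha : qPochInf a q ≠ 0) (n : ℕ) :
    qPoch a q n ≠ 0 := by
  rw [qPochInf_eq_mul hq1 a n] at ha
  exact left_ne_zero_of_mul ha

lemma norm_inv_qPoch_le {q : ℂ} (hq1 : ‖q‖ < 1) {a : ℂ} (ha : qPochInf a q ≠ 0) (n : ℕ) :
    ‖(qPoch a q n)⁻¹‖ ≤ Real.exp (‖a‖ / (1 - ‖q‖)) / ‖qPochInf a q‖ := by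
  have h0 : (0 : ℝ) < 1 - ‖q‖ := by linarith
  have h1 : (qPoch a q n)⁻¹ = qPochInf (a * q ^ n) q / qPochInf a q := by
    rw [eq_div_iff ha, qPochInf_eq_mul hq1 a n, inv_mul_cancel_left₀ (qPoch_ne_zero hq1 ha n)]
  rw [h1, norm_div]
  gcongr
  refine (norm_qPochInf_le hq1 _).trans (Real.exp_le_exp.2 ?_)
  gcongr
  rw [norm_mul, norm_pow]
  exact mul_le_of_le_one_right (norm_nonneg _) (pow_le_one₀ (norm_nonneg _) hq1.le)

lemma qPochInf_self_ne_zero {q : ℂ} (hq1 : ‖q‖ < 1) : qPochInf q q ≠ 0 :=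
  qPochInf_ne_zero_of_norm_lt hq1 hq1

lemma qPochInf_zero (q : ℂ) : qPochInf 0 q = 1 := by simp [qPochInf]

/-! ### Summation tools -/

/-- Absolutely convergent double series may be summed along sheared lines. -/
lemma hasSum_shear {κ : Type*} (s : κ → ℤ) {f : κ → ℂ} {g : ℤ → ℂ}
    (hf : Summable fun k => ‖f k‖) (hg : Summable fun j => ‖g j‖) :
    HasSum (fun n : ℤ => ∑' k, f k * g (n + s k)) ((∑' k, f k) * ∑' j, g j) := by
  let e : ℤ × κ ≃ κ × ℤ :=
    { toFun := fun p => (p.2, p.1 + s p.2)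
      invFun := fun p => (p.2 - s p.1, p.1)
      left_inv := fun p => by simp
      right_inv := fun p => by simp }
  have h1 : Summable fun x : κ × ℤ => f x.1 * g x.2 := (hf.mul_norm hg).of_norm
  have h2 : HasSum (fun x : κ × ℤ => f x.1 * g x.2) ((∑' k, f k) * ∑' j, g j) := by
    rw [tsum_mul_tsum_of_summable_norm hf hg]; exact h1.hasSum
  have h3 : HasSum (fun p : ℤ × κ => f p.2 * g (p.1 + s p.2)) ((∑' k, f k) * ∑' j, g j) :=
    (e.hasSum_iff (f := fun x : κ × ℤ => f x.1 * g x.2)).2 h2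
  exact h3.prod_fiberwise fun n => (h3.summable.prod_factor n).hasSum

lemma summable_shear {κ : Type*} (s : κ → ℤ) {f : κ → ℂ} {g : ℤ → ℂ}
    (hf : Summable fun k => ‖f k‖) (hg : Summable fun j => ‖g j‖) (n : ℤ) :
    Summable fun k => f k * g (n + s k) := by
  refine Summable.of_norm_bounded (hf.mul_right (∑' j, ‖g j‖)) fun k => ?_
  rw [norm_mul]
  gcongr
  exact hg.le_tsum _ fun _ _ => norm_nonneg _

/-- Iterating a `q`-difference equation leads to the value of a power series at `0`. -/
lemma tendsto_tsum_mul_pow_pow {q : ℂ} (hq1 : ‖q‖ < 1) {c : ℕ → ℂ} (hc : Summable fun n => ‖c n‖) :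
    Tendsto (fun N : ℕ => ∑' n, c n * (q ^ N) ^ n) atTop (𝓝 (c 0)) := by
  have h : ∑' n, (if n = 0 then c 0 else 0) = c 0 := tsum_ite_eq 0 (fun _ => c 0)
  rw [← h]
  refine tendsto_tsum_of_dominated_convergence hc (fun n => ?_) (Eventually.of_forall fun N n => ?_)
  · rcases eq_or_ne n 0 with rfl | hn
    · simp
    · have : Tendsto (fun N : ℕ => (q ^ n) ^ N) atTop (𝓝 0) := by
        refine tendsto_pow_atTop_nhds_zero_of_norm_lt_one ?_
        rw [norm_pow]; exact pow_lt_one₀ (norm_nonneg _) hq1 hn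
      simpa [hn, ← pow_mul, mul_comm] using this.const_mul (c n)
  · rw [norm_mul, norm_pow, norm_pow]
    exact mul_le_of_le_one_right (norm_nonneg _)
      (pow_le_one₀ (by positivity) (pow_le_one₀ (norm_nonneg _) hq1.le))

/-! ### Euler's two expansions -/

lemma summable_pow_div_qPoch {q : ℂ} (hq1 : ‖q‖ < 1) {y : ℂ} (hy : ‖y‖ < 1) :
    Summable fun n : ℕ => ‖y ^ n / qPoch q q n‖ := by
  refine Summable.of_nonneg_of_le (fun _ => norm_nonneg _) (fun n => ?_)
    ((summable_geometric_of_lt_one (norm_nonneg y) hy).mul_right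
      (Real.exp (‖q‖ / (1 - ‖q‖)) / ‖qPochInf q q‖))
  rw [div_eq_mul_inv, norm_mul, norm_pow]
  gcongr
  exact norm_inv_qPoch_le hq1 (qPochInf_self_ne_zero hq1) n

/-- Euler: `∑ yⁿ/(q;q)_n = 1/(y;q)_∞` for `|y| < 1`. -/
lemma tsum_pow_div_qPoch {q : ℂ} (hq1 : ‖q‖ < 1) {y : ℂ} (hy : ‖y‖ < 1) :
    ∑' n : ℕ, y ^ n / qPoch q q n = (qPochInf y q)⁻¹ := by
  have hE := qPochInf_self_ne_zero hq1
  have key : ∀ z : ℂ, ‖z‖ < 1 →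
      ∑' n : ℕ, (z * q) ^ n / qPoch q q n = (1 - z) * ∑' n : ℕ, z ^ n / qPoch q q n := by
    intro z hz
    have hzq : ‖z * q‖ < 1 := by
      rw [norm_mul]; exact mul_lt_one_of_nonneg_of_lt_one_left (norm_nonneg _) hz hq1.le
    have s1 := (summable_pow_div_qPoch hq1 hz).of_norm
    have s2 := (summable_pow_div_qPoch hq1 hzq).of_norm
    have h : ∑' n : ℕ, (z ^ n / qPoch q q n - (z * q) ^ n / qPoch q q n) =
        z * ∑' n : ℕ, z ^ n / qPoch q q n := by
      rw [(s1.sub s2).tsum_eq_zero_add, ← tsum_mul_left]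
      simp only [pow_zero, sub_self, zero_add]
      refine tsum_congr fun n => ?_
      have h1 := qPoch_ne_zero hq1 hE n
      have h2 := qPoch_ne_zero hq1 hE (n + 1)
      rw [qPoch_succ] at h2 ⊢
      have h3 := right_ne_zero_of_mul h2
      rw [mul_pow]
      field_simp
      ring
    rw [s1.tsum_sub s2] at h
    linear_combination -h
  have it : ∀ N : ℕ, ∑' n : ℕ, (y * q ^ N) ^ n / qPoch q q n =
      qPoch y q N * ∑' n : ℕ, y ^ n / qPoch q q n := by
    intro N
    induction N with
    | zero => simp [qPoch_zero]
    | succ N ih =>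
      have hN : ‖y * q ^ N‖ < 1 := by
        rw [norm_mul, norm_pow]
        exact mul_lt_one_of_nonneg_of_lt_one_left (norm_nonneg _) hy
          (pow_le_one₀ (norm_nonneg _) hq1.le)
      rw [pow_succ, ← mul_assoc, key _ hN, ih, qPoch_succ]; ring
  have t1 := tendsto_tsum_mul_pow_pow hq1 (summable_pow_div_qPoch hq1 hy)
  have t2 := (tendsto_qPoch hq1 y).mul_const (∑' n : ℕ, y ^ n / qPoch q q n)
  have := tendsto_nhds_unique (t1.congr fun N => ?_) t2
  · refine eq_inv_of_mul_eq_one_right ?_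
    rw [← this]
    simp [qPoch_zero]
  · rw [← it]
    exact tsum_congr fun n => by rw [mul_pow]; ring

lemma summable_euler {q : ℂ} (hq : q ≠ 0) (hq1 : ‖q‖ < 1) (x : ℂ) :
    Summable fun n : ℕ => ‖gauss q n * x ^ n / qPoch q q n‖ := by
  refine Summable.of_nonneg_of_le (fun _ => norm_nonneg _) (fun n => ?_)
    ((summable_gauss_nat hq hq1 x).mul_right
      (Real.exp (‖q‖ / (1 - ‖q‖)) / ‖qPochInf q q‖))
  rw [div_eq_mul_inv, norm_mul]
  gcongr
  exact norm_inv_qPoch_le hq1 (qPochInf_self_ne_zero hq1) n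

/-- Euler: `(x;q)_∞ = ∑ q^(n(n-1)/2) (-x)ⁿ/(q;q)_n`. -/
lemma qPochInf_eq_tsum {q : ℂ} (hq : q ≠ 0) (hq1 : ‖q‖ < 1) (x : ℂ) :
    qPochInf x q = ∑' n : ℕ, gauss q n * (-x) ^ n / qPoch q q n := by
  have hE := qPochInf_self_ne_zero hq1
  have key : ∀ z : ℂ, ∑' n : ℕ, gauss q n * (-z) ^ n / qPoch q q n =
      (1 - z) * ∑' n : ℕ, gauss q n * (-(z * q)) ^ n / qPoch q q n := by
    intro z
    have s1 := (summable_euler hq hq1 (-z)).of_norm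
    have s2 := (summable_euler hq hq1 (-(z * q))).of_norm
    have h : ∑' n : ℕ, (gauss q n * (-z) ^ n / qPoch q q n -
        gauss q n * (-(z * q)) ^ n / qPoch q q n) =
        -z * ∑' n : ℕ, gauss q n * (-(z * q)) ^ n / qPoch q q n := by
      rw [(s1.sub s2).tsum_eq_zero_add, ← tsum_mul_left]
      simp only [pow_zero, sub_self, zero_add]
      refine tsum_congr fun n => ?_
      have h1 := qPoch_ne_zero hq1 hE n
      have h2 := qPoch_ne_zero hq1 hE (n + 1)
      rw [qPoch_succ] at h2 ⊢
      have h3 := right_ne_zero_of_mul h2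
      push_cast
      rw [gauss_succ hq, zpow_natCast, show -(z * q) = (-z) * q by ring]
      generalize -z = w
      rw [mul_pow, mul_pow, pow_succ q, pow_succ w]
      rw [div_sub_div_same, mul_div_assoc', div_eq_div_iff h2 h1]
      ring
    rw [s1.tsum_sub s2] at h
    linear_combination h
  have it : ∀ N : ℕ, ∑' n : ℕ, gauss q n * (-x) ^ n / qPoch q q n =
      qPoch x q N * ∑' n : ℕ, gauss q n * (-(x * q ^ N)) ^ n / qPoch q q n := by
    intro N
    induction N with
    | zero => simp [qPoch_zero]
    | succ N ih => rw [ih, key, pow_succ, ← mul_assoc x, qPoch_succ]; ring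
  have t1 := tendsto_tsum_mul_pow_pow hq1 (summable_euler hq hq1 (-x))
  have t2 := (tendsto_qPoch hq1 x).mul t1
  refine (?_ : qPochInf x q = _).trans (tendsto_nhds_unique
    (a := qPochInf x q * (gauss q ((0 : ℕ) : ℤ) * (-x) ^ 0 / qPoch q q 0))
    (t2.congr fun N => ?_) tendsto_const_nhds)
  · simp [qPoch_zero, gauss_zero]
  · rw [it N]
    congr 1
    exact tsum_congr fun n => by rw [show -(x * q ^ N) = (-x) * q ^ N by ring, mul_pow (-x)]; ring

/-! ### Analyticity of power and Laurent series -/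

lemma differentiableOn_tsum_pow {c : ℕ → ℂ} {r : ℝ}
    (hc : Summable fun n => ‖c n‖ * r ^ n) :
    DifferentiableOn ℂ (fun z => ∑' n, c n * z ^ n) (Metric.ball 0 r) := by
  refine Complex.differentiableOn_tsum_of_summable_norm hc
      (fun n => by fun_prop) Metric.isOpen_ball fun n z hz => ?_
  rw [norm_mul, norm_pow]
  gcongr
  exact (mem_ball_zero_iff.1 hz).le

lemma differentiable_tsum_pow {c : ℕ → ℂ}
    (hc : ∀ r : ℝ, 0 < r → Summable fun n => ‖c n‖ * r ^ n) :
    Differentiable ℂ fun z => ∑' n, c n * z ^ n := fun z =>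
  (differentiableOn_tsum_pow (hc (‖z‖ + 1) (by positivity))).differentiableAt
    (Metric.isOpen_ball.mem_nhds (by simp))

lemma differentiableOn_tsum_zpow {c : ℤ → ℂ}
    (hc : ∀ r : ℝ, 0 < r → Summable fun n => ‖c n‖ * r ^ n) :
    DifferentiableOn ℂ (fun z => ∑' n, c n * z ^ n) {0}ᶜ := by
  intro z hz
  have hz0 : 0 < ‖z‖ := norm_pos_iff.2 hz
  let U : Set ℂ := {w | ‖z‖ / 2 < ‖w‖ ∧ ‖w‖ < 2 * ‖z‖}
  have hU : IsOpen U := (isOpen_lt continuous_const continuous_norm).inter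
    (isOpen_lt continuous_norm continuous_const)
  have h := Complex.differentiableOn_tsum_of_summable_norm (F := fun n z => c n * z ^ n)
    ((hc (‖z‖ / 2) (by positivity)).add (hc (2 * ‖z‖) (by positivity)))
    (fun n w hw => ?_) hU (fun n w hw => ?_)
  · exact (h.differentiableAt (hU.mem_nhds ⟨by linarith, by linarith⟩)).differentiableWithinAt
  · have hw0 : w ≠ 0 := norm_pos_iff.1 (lt_trans (by positivity) hw.1)
    exact ((differentiableAt_zpow.2 (Or.inl hw0)).const_mul _).differentiableWithinAt
  · rw [norm_mul, norm_zpow, ← mul_add]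
    have hw0 : 0 < ‖w‖ := lt_trans (by positivity) hw.1
    refine mul_le_mul_of_nonneg_left ?_ (norm_nonneg _)
    -- on the annulus, a power is dominated by its value on one of the two boundary circles
    rcases le_total 0 n with hn | hn
    · refine (zpow_le_zpow_left₀ hn hw0.le hw.2.le).trans ?_
      have : 0 < (‖z‖ / 2) ^ n := by positivity
      linarith
    · obtain ⟨k, rfl⟩ := Int.exists_eq_neg_ofNat hn
      have h1 : ‖w‖ ^ (-(k : ℤ)) ≤ (‖z‖ / 2) ^ (-(k : ℤ)) := by
        rw [zpow_neg, zpow_neg, zpow_natCast, zpow_natCast]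
        have := hw.1.le
        gcongr
      have : 0 < (2 * ‖z‖) ^ (-(k : ℤ)) := by positivity
      linarith

lemma differentiable_qPochInf {q : ℂ} (hq : q ≠ 0) (hq1 : ‖q‖ < 1) :
    Differentiable ℂ fun x => qPochInf x q := by
  have h := differentiable_tsum_pow (c := fun n : ℕ => gauss q n * (-1) ^ n / qPoch q q n)
    fun r hr => ?_
  · convert h using 2 with x
    rw [qPochInf_eq_tsum hq hq1]
    exact tsum_congr fun n => by rw [neg_pow x]; ring
  · refine (summable_euler hq hq1 r).congr fun n => ?_
    simp only [norm_mul, norm_div, norm_pow, norm_neg, norm_one, one_pow, Complex.norm_real,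
      Real.norm_of_nonneg hr.le]
    ring

/-! ### The theta function -/

lemma theta_eq (q x : ℂ) : theta q x = ∑' n : ℤ, gauss q n * x ^ n := rfl

/-- Quasi-periodicity of the theta function. -/
lemma theta_zpow_mul {q : ℂ} (hq : q ≠ 0) {x : ℂ} (hx : x ≠ 0) (n : ℤ) :
    theta q (q ^ n * x) = theta q x / (gauss q n * x ^ n) := by
  rw [eq_div_iff (mul_ne_zero (gauss_ne_zero hq n) (zpow_ne_zero n hx)), theta_eq, theta_eq,
    ← tsum_mul_right, ← (Equiv.addLeft n).tsum_eq fun k => gauss q k * x ^ k]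
  refine tsum_congr fun k => ?_
  rw [Equiv.coe_addLeft, gauss_add hq, zpow_add₀ hx, mul_zpow, zpow_mul]
  ring

lemma theta_q_mul {q : ℂ} (hq : q ≠ 0) {x : ℂ} (hx : x ≠ 0) :
    theta q (q * x) = theta q x / x := by
  simpa [gauss] using theta_zpow_mul hq hx 1

/-- The triple product in the region where `1/(-q/x;q)_∞` has a convergent expansion: the
coefficients of `θ(x)/(-q/x;q)_∞` are those of `(q;q)_∞(-x;q)_∞`. -/
lemma theta_eq_of_norm_lt {q : ℂ} (hq : q ≠ 0) (hq1 : ‖q‖ < 1) {x : ℂ} (hx : x ≠ 0)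
    (h : ‖q / x‖ < 1) :
    theta q x = qPochInf q q * qPochInf (-x) q * qPochInf (-(q / x)) q := by
  have hE := qPochInf_self_ne_zero hq1
  have hy : ‖-(q / x)‖ < 1 := by rwa [norm_neg]
  have H := hasSum_shear (fun k : ℕ => (k : ℤ)) (summable_pow_div_qPoch hq1 hy)
    (summable_gauss_int hq hq1 hx)
  rw [tsum_pow_div_qPoch hq1 hy, ← theta_eq] at H
  have inner : ∀ n : ℤ, ∑' k : ℕ, (-(q / x)) ^ k / qPoch q q k *
      (gauss q (n + k) * x ^ (n + (k : ℤ))) = gauss q n * x ^ n * qPochInf (q ^ (n + 1)) q := by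
    intro n
    rw [qPochInf_eq_tsum hq hq1, ← tsum_mul_left]
    refine tsum_congr fun k => ?_
    rw [gauss_add hq, zpow_add₀ hx, zpow_natCast, zpow_mul, zpow_natCast, zpow_add₀ hq, zpow_one,
      neg_pow, neg_pow (q ^ n * q), div_pow, mul_pow]
    field_simp
  simp only [inner] at H
  -- the coefficients with `n < 0` vanish since `(q^(n+1);q)_∞ = 0`
  rw [← (Nat.cast_injective (R := ℤ)).hasSum_iff] at H
  · have H2 : HasSum ((fun n : ℤ => gauss q n * x ^ n * qPochInf (q ^ (n + 1)) q) ∘ Nat.cast)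
        (qPochInf q q * qPochInf (-x) q) := by
      rw [qPochInf_eq_tsum hq hq1 (-x), neg_neg]
      refine Eq.mpr (congrArg (HasSum · _) (funext fun n => ?_))
        (((summable_euler hq hq1 x).of_norm.hasSum).mul_left (qPochInf q q))
      have h1 := qPoch_ne_zero hq1 hE n
      rw [Function.comp_apply, qPochInf_eq_mul hq1 q n, zpow_natCast, zpow_add₀ hq, zpow_one,
        zpow_natCast, mul_comm (q ^ n) q]
      field_simp
    have h3 := H.unique H2
    have h4 := qPochInf_ne_zero_of_norm_lt hq1 hy
    rw [← h3]
    field_simp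
  · intro n hn
    have hn' : n < 0 := by
      by_contra! h0
      exact hn ⟨n.toNat, by simp [h0]⟩
    have : qPochInf (q ^ (n + 1)) q = 0 := by
      rw [qPochInf_eq_zero_iff hq1]
      refine ⟨(-(n + 1)).toNat, ?_⟩
      rw [← zpow_natCast, Int.toNat_of_nonneg (by omega), ← zpow_add₀ hq]
      simp
    rw [this, mul_zero]

/-- Jacobi's triple product identity. -/
lemma theta_eq_prod {q : ℂ} (hq : q ≠ 0) (hq1 : ‖q‖ < 1) {x : ℂ} (hx : x ≠ 0) :
    theta q x = qPochInf q q * qPochInf (-x) q * qPochInf (-(q / x)) q := by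
  have step : ∀ N : ℕ, ∀ x : ℂ, x ≠ 0 → ‖q / x‖ * ‖q‖ ^ N < 1 →
      theta q x = qPochInf q q * qPochInf (-x) q * qPochInf (-(q / x)) q := by
    intro N
    induction N with
    | zero => intro x hx h; exact theta_eq_of_norm_lt hq hq1 hx (by simpa using h)
    | succ N ih =>
      intro x hx h
      have hy : x / q ≠ 0 := div_ne_zero hx hq
      have h1 := ih (x / q) hy (by
        refine lt_of_eq_of_lt ?_ h
        rw [show q / (x / q) = q / x * q by field_simp, norm_mul, pow_succ]; ring)
      have h2 := theta_q_mul hq hy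
      rw [mul_div_cancel₀ _ hq] at h2
      have e1 := qPochInf_eq_one_sub_mul hq1 (-(x / q))
      have e2 := qPochInf_eq_one_sub_mul hq1 (-(q / x))
      rw [show -(x / q) * q = -x by field_simp] at e1
      rw [show -(q / x) * q = -(q / (x / q)) by field_simp] at e2
      rw [h2, h1, e1, e2]
      field_simp
      ring
  have ht : Tendsto (fun N : ℕ => ‖q / x‖ * ‖q‖ ^ N) atTop (𝓝 (‖q / x‖ * 0)) :=
    (tendsto_pow_atTop_nhds_zero_of_lt_one (norm_nonneg _) hq1).const_mul _
  rw [mul_zero] at ht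
  obtain ⟨N, hN⟩ := (ht.eventually_lt_const one_pos).exists
  exact step N x hx hN

/-- The symmetry `θ(q/x) = θ(x)`, visible on the triple product. -/
lemma theta_q_div {q : ℂ} (hq : q ≠ 0) (hq1 : ‖q‖ < 1) {x : ℂ} (hx : x ≠ 0) :
    theta q (q / x) = theta q x := by
  rw [theta_eq_prod hq hq1 hx, theta_eq_prod hq hq1 (div_ne_zero hq hx)]
  rw [show q / (q / x) = x by field_simp]
  ring

lemma theta_eq_zero_iff {q : ℂ} (hq : q ≠ 0) (hq1 : ‖q‖ < 1) {x : ℂ} (hx : x ≠ 0) :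
    theta q x = 0 ↔ ∃ n : ℤ, x = -q ^ n := by
  rw [theta_eq_prod hq hq1 hx, mul_eq_zero, mul_eq_zero, qPochInf_eq_zero_iff hq1 (-x),
    qPochInf_eq_zero_iff hq1 (-(q / x))]
  simp only [qPochInf_self_ne_zero hq1, false_or]
  constructor
  · rintro (⟨k, hk⟩ | ⟨k, hk⟩)
    · refine ⟨-k, ?_⟩
      rw [zpow_neg, zpow_natCast]
      have : q ^ k ≠ 0 := pow_ne_zero _ hq
      field_simp
      linear_combination -hk
    · refine ⟨k + 1, ?_⟩
      rw [zpow_add₀ hq, zpow_natCast, zpow_one]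
      field_simp at hk
      linear_combination -hk
  · rintro ⟨n, rfl⟩
    rcases le_or_gt n 0 with hn | hn
    · obtain ⟨k, rfl⟩ := Int.exists_eq_neg_ofNat hn
      refine Or.inl ⟨k, ?_⟩
      rw [zpow_neg, zpow_natCast, neg_neg, inv_mul_cancel₀ (pow_ne_zero _ hq)]
    · obtain ⟨k, rfl⟩ : ∃ k : ℕ, n = k + 1 := ⟨(n - 1).toNat, by omega⟩
      refine Or.inr ⟨k, ?_⟩
      rw [zpow_add₀ hq, zpow_natCast, zpow_one]
      have : q ^ k ≠ 0 := pow_ne_zero _ hq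
      field_simp

lemma differentiableOn_theta {q : ℂ} (hq : q ≠ 0) (hq1 : ‖q‖ < 1) :
    DifferentiableOn ℂ (theta q) {0}ᶜ := by
  refine differentiableOn_tsum_zpow (c := gauss q) fun r hr => ?_
  refine (summable_gauss_int hq hq1 (x := r) (by exact_mod_cast hr.ne')).congr fun n => ?_
  rw [norm_mul, norm_zpow, Complex.norm_real, Real.norm_of_nonneg hr.le]

lemma differentiableAt_theta {q : ℂ} (hq : q ≠ 0) (hq1 : ‖q‖ < 1) {x : ℂ} (hx : x ≠ 0) :
    DifferentiableAt ℂ (theta q) x :=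
  (differentiableOn_theta hq hq1).differentiableAt (isOpen_compl_singleton.mem_nhds hx)

lemma theta_neg_one {q : ℂ} (hq : q ≠ 0) (hq1 : ‖q‖ < 1) : theta q (-1) = 0 :=
  (theta_eq_zero_iff hq hq1 (by simp)).2 ⟨0, by simp⟩

lemma theta_one_ne_zero {q : ℂ} (hq : q ≠ 0) (hq1 : ‖q‖ < 1) : theta q 1 ≠ 0 := by
  rw [Ne, theta_eq_zero_iff hq hq1 one_ne_zero]
  rintro ⟨n, hn⟩
  have h : ‖q‖ ^ n = 1 := by rw [← norm_zpow, ← norm_neg, ← hn, norm_one]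
  rcases (zpow_eq_one_iff_right₀ (norm_nonneg _) hq1.ne).1 h with rfl
  norm_num at hn

/-! ### Kronecker's bilateral sum -/

lemma exists_forall_norm_le_of_tendsto {u : ℕ → ℂ} {l : ℂ} (h : Tendsto u atTop (𝓝 l)) :
    ∃ C, 0 ≤ C ∧ ∀ n, ‖u n‖ ≤ C := by
  obtain ⟨C, hC⟩ := (Metric.isBounded_range_of_tendsto u h).exists_norm_le
  exact ⟨C, (norm_nonneg (u 0)).trans (hC _ ⟨0, rfl⟩), fun n => hC _ ⟨n, rfl⟩⟩

/-- Bounds for the coefficients `1/(1-cqʲ)` of Kronecker's sum in both directions. -/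
lemma exists_bound_kronecker {q : ℂ} (hq1 : ‖q‖ < 1) {c : ℂ} (hc : c ≠ 0) :
    ∃ C, 0 ≤ C ∧ (∀ j : ℕ, ‖(1 - c * q ^ j)⁻¹‖ ≤ C) ∧ ∀ j : ℕ, ‖(q ^ j - c)⁻¹‖ ≤ C := by
  have hp : Tendsto (fun j : ℕ => q ^ j) atTop (𝓝 0) :=
    tendsto_pow_atTop_nhds_zero_of_norm_lt_one hq1
  have h1 : Tendsto (fun j : ℕ => (1 - c * q ^ j)⁻¹) atTop (𝓝 (1 - c * 0)⁻¹) :=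
    (tendsto_const_nhds.sub (hp.const_mul c)).inv₀ (by simp)
  have h2 : Tendsto (fun j : ℕ => (q ^ j - c)⁻¹) atTop (𝓝 (0 - c)⁻¹) :=
    (hp.sub_const c).inv₀ (by simpa using hc)
  obtain ⟨C, hC, h1⟩ := exists_forall_norm_le_of_tendsto h1
  obtain ⟨D, hD, h2⟩ := exists_forall_norm_le_of_tendsto h2
  exact ⟨C + D, by positivity, fun j => (h1 j).trans (by linarith),
    fun j => (h2 j).trans (by linarith)⟩

/-- The terms of Kronecker's sum with negative index, in terms of `q/z`. -/
lemma kronecker_term_neg {q : ℂ} (hq : q ≠ 0) (z c : ℂ) (j : ℕ) :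
    z ^ (-(j : ℤ)) / (1 - c * q ^ (-(j : ℤ))) = (q / z) ^ j * (q ^ j - c)⁻¹ := by
  have hqj : q ^ j ≠ 0 := pow_ne_zero _ hq
  rw [zpow_neg, zpow_neg, zpow_natCast, zpow_natCast, div_pow,
    show 1 - c * (q ^ j)⁻¹ = (q ^ j - c) / q ^ j by field_simp]
  rw [div_div_eq_mul_div, div_eq_mul_inv, div_eq_mul_inv]
  ring

lemma norm_div_lt_one_of_lt {q z : ℂ} (hqz : ‖q‖ < ‖z‖) : ‖q / z‖ < 1 := by
  rw [norm_div, div_lt_one ((norm_nonneg q).trans_lt hqz)]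
  exact hqz

lemma summable_kronecker {q : ℂ} (hq : q ≠ 0) (hq1 : ‖q‖ < 1) {c z : ℂ} (hc : c ≠ 0)
    (hqz : ‖q‖ < ‖z‖) (hz : ‖z‖ < 1) :
    Summable fun j : ℤ => ‖z ^ j / (1 - c * q ^ j)‖ := by
  obtain ⟨C, hC, h1, h2⟩ := exists_bound_kronecker hq1 hc
  refine Summable.of_nat_of_neg ?_ ?_
  · refine Summable.of_nonneg_of_le (fun _ => norm_nonneg _) (fun j => ?_)
      ((summable_geometric_of_lt_one (norm_nonneg z) hz).mul_right C)
    rw [zpow_natCast, zpow_natCast, div_eq_mul_inv, norm_mul, norm_pow]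
    gcongr
    exact h1 j
  · refine Summable.of_nonneg_of_le (fun _ => norm_nonneg _) (fun j => ?_)
      ((summable_geometric_of_lt_one (norm_nonneg (q / z)) (norm_div_lt_one_of_lt hqz)).mul_right C)
    rw [kronecker_term_neg hq, norm_mul, norm_pow]
    gcongr
    exact h2 j

/-- The pole of Kronecker's sum at `z = 1` is simple with residue `-1`. -/
lemma tendsto_kronecker {q : ℂ} (hq : q ≠ 0) (hq1 : ‖q‖ < 1) {c : ℂ} (hc : c ≠ 0)
    (hcq : ∀ n : ℤ, c * q ^ n ≠ 1) :
    Tendsto (fun z => (1 - z) * ∑' j : ℤ, z ^ j / (1 - c * q ^ j))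
      (𝓝[Metric.ball 0 1] 1) (𝓝 1) := by
  obtain ⟨C, hC, h1, h2⟩ := exists_bound_kronecker hq1 hc
  obtain ⟨r, hr, hr1⟩ := exists_between hq1
  have hr0 : 0 < r := (norm_nonneg q).trans_lt hr
  have hqr : ‖q‖ / r < 1 := (div_lt_one hr0).2 hr
  set M : ℝ := (∑' j : ℕ, ‖c‖ * ‖q‖ ^ j * C) + ∑' j : ℕ, (‖q‖ / r) ^ (j + 1) * C
  -- for `j ≥ 0` the terms differ from `z^j` by `O(q^j)`, and the `z^j` add up to `1/(1-z)`; the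
  -- rest is bounded near `z = 1`
  have key : ∀ z : ℂ, r < ‖z‖ → ‖z‖ < 1 →
      ‖(1 - z) * (∑' j : ℤ, z ^ j / (1 - c * q ^ j)) - 1‖ ≤ ‖1 - z‖ * M := by
    intro z hrz hz
    have hz1 : 1 - z ≠ 0 := by
      intro h
      rw [← sub_eq_zero.1 h, norm_one] at hz
      exact lt_irrefl _ hz
    have b1 : ∀ j : ℕ, ‖z ^ j * (c * q ^ j * (1 - c * q ^ j)⁻¹)‖ ≤ ‖c‖ * ‖q‖ ^ j * C := by
      intro j
      rw [norm_mul, norm_mul, norm_mul, norm_pow, norm_pow]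
      refine (mul_le_of_le_one_left (by positivity) (pow_le_one₀ (norm_nonneg _) hz.le)).trans ?_
      gcongr
      exact h1 j
    have b2 : ∀ j : ℕ, ‖z ^ (-((j : ℤ) + 1)) / (1 - c * q ^ (-((j : ℤ) + 1)))‖ ≤
        (‖q‖ / r) ^ (j + 1) * C := by
      intro j
      have := kronecker_term_neg hq z c (j + 1)
      push_cast at this
      rw [this, norm_mul, norm_pow, norm_div]
      gcongr
      exact h2 (j + 1)
    have s1 : Summable fun j : ℕ => ‖c‖ * ‖q‖ ^ j * C :=
      ((summable_geometric_of_lt_one (norm_nonneg q) hq1).mul_left _).mul_right _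
    have s2 : Summable fun j : ℕ => (‖q‖ / r) ^ (j + 1) * C :=
      ((summable_nat_add_iff 1).2 (summable_geometric_of_lt_one (by positivity) hqr)).mul_right _
    have g1 := (Summable.of_norm_bounded s1 b1).hasSum
    have g2 := (Summable.of_norm_bounded s2 b2).hasSum
    have g3 := (hasSum_geometric_of_norm_lt_one hz).add g1
    have g4 : HasSum (fun j : ℕ => z ^ (j : ℤ) / (1 - c * q ^ (j : ℤ)))
        ((1 - z)⁻¹ + ∑' j : ℕ, z ^ j * (c * q ^ j * (1 - c * q ^ j)⁻¹)) := by
      refine Eq.mpr (congrArg (HasSum · _) (funext fun j => ?_)) g3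
      have : 1 - c * q ^ j ≠ 0 := fun h => hcq j (by rw [zpow_natCast]; linear_combination -h)
      rw [zpow_natCast, zpow_natCast]
      field_simp
      ring
    have g5 := (HasSum.of_nat_of_neg_add_one (f := fun j : ℤ => z ^ j / (1 - c * q ^ j))
      g4 g2).tsum_eq
    have n1 := tsum_of_norm_bounded s1.hasSum b1
    have n2 := tsum_of_norm_bounded s2.hasSum b2
    rw [g5]
    clear g1 g2 g3 g4 g5 b1 b2
    generalize ∑' j : ℕ, z ^ j * (c * q ^ j * (1 - c * q ^ j)⁻¹) = u at *
    generalize ∑' j : ℕ, z ^ (-((j : ℤ) + 1)) / (1 - c * q ^ (-((j : ℤ) + 1))) = v at *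
    have e : (1 - z) * ((1 - z)⁻¹ + u + v) - 1 = (1 - z) * (u + v) := by
      rw [add_assoc, mul_add, mul_inv_cancel₀ hz1]; ring
    rw [e, norm_mul]
    exact mul_le_mul_of_nonneg_left ((norm_add_le _ _).trans (add_le_add n1 n2)) (norm_nonneg _)
  rw [tendsto_iff_norm_sub_tendsto_zero]
  refine squeeze_zero' (Eventually.of_forall fun _ => norm_nonneg _)
    (g := fun z => ‖1 - z‖ * M) ?_ ?_
  · have h1 : ∀ᶠ z : ℂ in 𝓝[Metric.ball 0 1] 1, r < ‖z‖ :=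
      nhdsWithin_le_nhds (continuous_norm.continuousAt.eventually_const_lt (by simpa using hr1))
    filter_upwards [h1, self_mem_nhdsWithin] with z hz1 hz2
    exact key z hz1 (by simpa using hz2)
  · have : Continuous fun z : ℂ => ‖1 - z‖ * M := by fun_prop
    simpa using (this.tendsto 1).mono_left nhdsWithin_le_nhds

/-- Kronecker's identity `∑_{j ∈ ℤ} zʲ/(1-cqʲ) = (q;q)_∞³ θ(-cz)/(θ(-c)θ(-z))`. The Laurent
coefficients of `θ(-z) ∑ zʲ/(1-cqʲ)` obey the recurrence of those of `θ(-cz)`, and the pole at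
`z = 1` fixes the factor. -/
lemma theta_mul_kronecker {q : ℂ} (hq : q ≠ 0) (hq1 : ‖q‖ < 1) {c z : ℂ} (hc : c ≠ 0)
    (hcq : ∀ n : ℤ, c * q ^ n ≠ 1) (hqz : ‖q‖ < ‖z‖) (hz : ‖z‖ < 1) :
    theta q (-z) * ∑' j : ℤ, z ^ j / (1 - c * q ^ j) =
      qPochInf q q ^ 3 * theta q (-(c * z)) / theta q (-c) := by
  set s : ℤ → ℂ := fun n => ∑' k : ℤ, gauss q k * (-1) ^ k / (1 - c * q ^ (n - k)) with hs
  have hd : ∀ n : ℤ, 1 - c * q ^ n ≠ 0 := fun n h => hcq n (by linear_combination -h)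
  have hz0 : z ≠ 0 := norm_pos_iff.1 ((norm_nonneg q).trans_lt hqz)
  have hterm : ∀ z : ℂ, z ≠ 0 → ∀ n k : ℤ,
      gauss q k * (-z) ^ k * (z ^ (n + -k) / (1 - c * q ^ (n + -k))) =
        gauss q k * (-1) ^ k / (1 - c * q ^ (n - k)) * z ^ n := by
    intro z hz0 n k
    rw [zpow_add₀ hz0, zpow_neg, ← neg_one_mul, mul_zpow, ← sub_eq_add_neg]
    have : z ^ k ≠ 0 := zpow_ne_zero _ hz0
    field_simp
  have H : ∀ z : ℂ, ‖q‖ < ‖z‖ → ‖z‖ < 1 →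
      HasSum (fun n => s n * z ^ n) (theta q (-z) * ∑' j : ℤ, z ^ j / (1 - c * q ^ j)) := by
    intro z hqz hz
    have hz0 : z ≠ 0 := norm_pos_iff.1 ((norm_nonneg q).trans_lt hqz)
    have h := hasSum_shear (fun k : ℤ => -k) (summable_gauss_int hq hq1 (neg_ne_zero.2 hz0))
      (summable_kronecker hq hq1 hc hqz hz)
    simp only [hterm z hz0, tsum_mul_right] at h
    exact h
  have hsum : ∀ n : ℤ, Summable fun k : ℤ => gauss q k * (-1) ^ k / (1 - c * q ^ (n - k)) := by
    intro n
    have h := summable_shear (fun k : ℤ => -k) (summable_gauss_int hq hq1 (neg_ne_zero.2 hz0))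
      (summable_kronecker hq hq1 hc hqz hz) n
    simp only [hterm z hz0] at h
    exact (summable_mul_right_iff (zpow_ne_zero n hz0)).1 h
  have hshift : ∀ n k : ℤ, gauss q (k - 1) * (-1) ^ (k - 1) / (1 - c * q ^ (n - (k - 1))) =
      -(gauss q k * (-1) ^ k * q ^ (-k) * q / (1 - c * q ^ (n + 1 - k))) := by
    intro n k
    have h1 : gauss q k = gauss q (k - 1) * (q ^ k / q) := by
      rw [div_eq_mul_inv, ← zpow_sub_one₀ hq, ← gauss_succ hq, sub_add_cancel]
    have h2 : q ^ k ≠ 0 := zpow_ne_zero _ hq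
    rw [show n - (k - 1) = n + 1 - k by ring, h1, zpow_neg, zpow_sub_one₀ (by norm_num), ← neg_div]
    congr 1
    field_simp
  -- the recurrence of the coefficients; it is homogeneous because `θ(-1) = 0`
  have hrec : ∀ n : ℤ, s (n + 1) = -c * q ^ n * s n := by
    intro n
    have e1 : s n =
        -(∑' k : ℤ, gauss q k * (-1) ^ k * q ^ (-k) * q / (1 - c * q ^ (n + 1 - k))) := by
      rw [hs, ← tsum_neg]
      dsimp only
      rw [← (Equiv.subRight (1 : ℤ)).tsum_eq]
      exact tsum_congr fun k => hshift n k
    have s2 : Summable fun k : ℤ =>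
        gauss q k * (-1) ^ k * q ^ (-k) * q / (1 - c * q ^ (n + 1 - k)) := by
      refine ((Equiv.subRight (1 : ℤ)).summable_iff.2 (hsum n)).neg.congr fun k => ?_
      rw [Function.comp_apply, Equiv.subRight_apply, hshift n k, neg_neg]
    have e2 : s (n + 1) - c * q ^ n *
        (∑' k : ℤ, gauss q k * (-1) ^ k * q ^ (-k) * q / (1 - c * q ^ (n + 1 - k))) =
          theta q (-1) := by
      rw [theta_eq, ← tsum_mul_left, hs, ← (hsum (n + 1)).tsum_sub (s2.mul_left _)]
      refine tsum_congr fun k => ?_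
      have h3 := hd (n + 1 - k)
      have h4 : q ^ (n + 1 - k) = q ^ n * q * q ^ (-k) := by
        rw [sub_eq_add_neg, zpow_add₀ hq, zpow_add₀ hq, zpow_one]
      rw [mul_div_assoc', div_sub_div_same, div_eq_iff h3, h4]
      ring
    rw [theta_neg_one hq hq1] at e2
    rw [e1]
    linear_combination e2
  have sol : ∀ n : ℤ, s n = s 0 * (gauss q n * (-c) ^ n) := by
    intro n
    induction n with
    | zero => simp [gauss_zero]
    | succ n ih =>
      rw [hrec, ih, gauss_succ hq, zpow_add_one₀ (neg_ne_zero.2 hc)]; ring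
    | pred n ih =>
      have h1 := hrec (-(n : ℤ) - 1)
      have h2 := gauss_succ hq (-(n : ℤ) - 1)
      rw [sub_add_cancel] at h1 h2
      have h3 : -c * q ^ (-(n : ℤ) - 1) ≠ 0 :=
        mul_ne_zero (neg_ne_zero.2 hc) (zpow_ne_zero _ hq)
      refine mul_left_cancel₀ h3 ?_
      rw [← h1, ih, h2, zpow_sub_one₀ (neg_ne_zero.2 hc)]
      field_simp
  have K : ∀ z : ℂ, ‖q‖ < ‖z‖ → ‖z‖ < 1 →
      theta q (-z) * ∑' j : ℤ, z ^ j / (1 - c * q ^ j) = s 0 * theta q (-(c * z)) := by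
    intro z hqz hz
    rw [← (H z hqz hz).tsum_eq, theta_eq, ← tsum_mul_left]
    refine tsum_congr fun n => ?_
    rw [sol n, ← neg_mul, mul_zpow]; ring
  have hθc : theta q (-c) ≠ 0 := by
    rw [Ne, theta_eq_zero_iff hq hq1 (neg_ne_zero.2 hc)]
    rintro ⟨n, hn⟩
    refine hcq (-n) ?_
    rw [neg_inj.1 hn, ← zpow_add₀ hq]; simp
  -- the factor `1 - z` of `θ(-z)` cancels the pole of Kronecker's sum, and `z → 1` gives `s 0`
  have lim : s 0 * theta q (-c) = qPochInf q q ^ 3 := by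
    have hcE : Continuous fun x => qPochInf x q := (differentiable_qPochInf hq hq1).continuous
    have t1 : Tendsto (fun z : ℂ => s 0 * theta q (-(c * z))) (𝓝[Metric.ball 0 1] 1)
        (𝓝 (s 0 * theta q (-c))) := by
      have : ContinuousAt (fun z : ℂ => s 0 * theta q (-(c * z))) 1 := by
        refine continuousAt_const.mul (ContinuousAt.comp (g := theta q) ?_ (by fun_prop))
        exact (differentiableAt_theta hq hq1 (by simpa using hc)).continuousAt
      simpa using this.tendsto.mono_left nhdsWithin_le_nhds
    have t2 : Tendsto (fun z : ℂ => qPochInf q q * qPochInf (z * q) q * qPochInf (q / z) q *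
        ((1 - z) * ∑' j : ℤ, z ^ j / (1 - c * q ^ j))) (𝓝[Metric.ball 0 1] 1)
        (𝓝 (qPochInf q q * qPochInf q q * qPochInf q q * 1)) := by
      refine Tendsto.mul ?_ (tendsto_kronecker hq hq1 hc hcq)
      have : ContinuousAt
          (fun z : ℂ => qPochInf q q * qPochInf (z * q) q * qPochInf (q / z) q) 1 := by
        refine (continuousAt_const.mul (hcE.continuousAt.comp (by fun_prop))).mul
          (hcE.continuousAt.comp ?_)
        exact continuousAt_const.div continuousAt_id one_ne_zero
      simpa using this.tendsto.mono_left nhdsWithin_le_nhds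
    have hne : (𝓝[Metric.ball (0 : ℂ) 1] 1).NeBot := by
      rw [← mem_closure_iff_nhdsWithin_neBot, closure_ball _ one_ne_zero]
      simp
    have := tendsto_nhds_unique (t1.congr' ?_) t2
    · rw [this]; ring
    · have h1 : ∀ᶠ z : ℂ in 𝓝[Metric.ball 0 1] 1, ‖q‖ < ‖z‖ :=
        nhdsWithin_le_nhds (continuous_norm.continuousAt.eventually_const_lt (by simpa using hq1))
      filter_upwards [h1, self_mem_nhdsWithin] with z hz1 hz2
      have hz0 : z ≠ 0 := norm_pos_iff.1 ((norm_nonneg q).trans_lt hz1)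
      rw [← K z hz1 (by simpa using hz2), theta_eq_prod hq hq1 (neg_ne_zero.2 hz0), neg_neg,
        show -(q / -z) = q / z by rw [div_neg, neg_neg], qPochInf_eq_one_sub_mul hq1 z]
      ring
  rw [K z hqz hz, eq_div_iff hθc, ← lim]
  ring

/-! ### The confluent series -/

/-- The coefficients of the confluent series `₁φ₁(a; c; q, w)`. -/
noncomputable def confCoeff (a c q : ℂ) (k : ℕ) : ℂ :=
  qPoch a q k / (qPoch c q k * qPoch q q k) * (gauss q k * (-1) ^ k)

/-- The entire function `₁φ₁(a; c; q, w)` of `w`. -/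
noncomputable def conf (a c q w : ℂ) : ℂ := ∑' k : ℕ, confCoeff a c q k * w ^ k

/-- The coefficients of `₁φ₁` are bounded by a multiple of the Gaussian weight, so that the series
is entire. -/
lemma norm_confCoeff_le {q : ℂ} (hq1 : ‖q‖ < 1) (a : ℂ) {c : ℂ} (hc : qPochInf c q ≠ 0) (k : ℕ) :
    ‖confCoeff a c q k‖ ≤ Real.exp (‖a‖ / (1 - ‖q‖)) *
      (Real.exp (‖c‖ / (1 - ‖q‖)) / ‖qPochInf c q‖) *
      (Real.exp (‖q‖ / (1 - ‖q‖)) / ‖qPochInf q q‖) * ‖gauss q k‖ := by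
  have e : confCoeff a c q k =
      qPoch a q k * (qPoch c q k)⁻¹ * (qPoch q q k)⁻¹ * gauss q k * (-1) ^ k := by
    rw [confCoeff, div_eq_mul_inv, mul_inv]; ring
  rw [e, norm_mul, norm_mul, norm_mul, norm_mul, norm_pow, norm_neg, norm_one, one_pow, mul_one]
  gcongr
  · exact norm_qPoch_le hq1 a k
  · exact norm_inv_qPoch_le hq1 hc k
  · exact norm_inv_qPoch_le hq1 (qPochInf_self_ne_zero hq1) k

lemma summable_conf {q : ℂ} (hq : q ≠ 0) (hq1 : ‖q‖ < 1) (a : ℂ) {c : ℂ} (hc : qPochInf c q ≠ 0)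
    (w : ℂ) : Summable fun k : ℕ => ‖confCoeff a c q k * w ^ k‖ := by
  refine Summable.of_nonneg_of_le (fun _ => norm_nonneg _) (fun k => ?_)
    ((summable_gauss_nat hq hq1 w).mul_left (Real.exp (‖a‖ / (1 - ‖q‖)) *
      (Real.exp (‖c‖ / (1 - ‖q‖)) / ‖qPochInf c q‖) *
      (Real.exp (‖q‖ / (1 - ‖q‖)) / ‖qPochInf q q‖)))
  rw [norm_mul, norm_mul, ← mul_assoc]
  gcongr
  exact norm_confCoeff_le hq1 a hc k

lemma differentiable_conf {q : ℂ} (hq : q ≠ 0) (hq1 : ‖q‖ < 1) (a : ℂ) {c : ℂ}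
    (hc : qPochInf c q ≠ 0) : Differentiable ℂ (conf a c q) := by
  refine differentiable_tsum_pow fun r hr => ?_
  refine (summable_conf hq hq1 a hc r).congr fun k => ?_
  rw [norm_mul, norm_pow, Complex.norm_real, Real.norm_of_nonneg hr.le]

/-- `₁φ₁` depends continuously on its parameters and its argument jointly. -/
lemma continuousAt_conf {q : ℂ} (hq : q ≠ 0) (hq1 : ‖q‖ < 1) {a c w : ℂ → ℂ} {x : ℂ}
    (ha : ContinuousAt a x) (hc : ContinuousAt c x) (hw : ContinuousAt w x)
    (hcx : qPochInf (c x) q ≠ 0) : ContinuousAt (fun y => conf (a y) (c y) q (w y)) x := by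
  have hE : ContinuousAt (fun y => qPochInf (c y) q) x :=
    (differentiable_qPochInf hq hq1).continuous.continuousAt.comp hc
  have e0 : 0 < ‖qPochInf (c x) q‖ := norm_pos_iff.2 hcx
  have e1 := ha.norm.eventually_lt_const (lt_add_one ‖a x‖)
  have e2 := hc.norm.eventually_lt_const (lt_add_one ‖c x‖)
  have e3 := hw.norm.eventually_lt_const (lt_add_one ‖w x‖)
  have e4 := hE.norm.eventually_const_lt (half_lt_self e0)
  refine tendsto_tsum_of_dominated_convergence
    (bound := fun k : ℕ => Real.exp ((‖a x‖ + 1) / (1 - ‖q‖)) *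
      (Real.exp ((‖c x‖ + 1) / (1 - ‖q‖)) / (‖qPochInf (c x) q‖ / 2)) *
      (Real.exp (‖q‖ / (1 - ‖q‖)) / ‖qPochInf q q‖) * ‖gauss q k * ((‖w x‖ + 1 : ℝ) : ℂ) ^ k‖)
    ((summable_gauss_nat hq hq1 _).mul_left _) (fun k => ?_) ?_
  · have hp : ∀ u : ℂ → ℂ, ContinuousAt u x → ContinuousAt (fun y => qPoch (u y) q k) x := by
      intro u hu
      unfold qPoch
      fun_prop
    have h0 : qPoch (c x) q k * qPoch q q k ≠ 0 :=
      mul_ne_zero (qPoch_ne_zero hq1 hcx k) (qPoch_ne_zero hq1 (qPochInf_self_ne_zero hq1) k)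
    exact ((((hp a ha).div ((hp c hc).mul continuousAt_const) h0).mul continuousAt_const).mul
      (hw.pow k)).tendsto
  · filter_upwards [e1, e2, e3, e4] with y h1 h2 h3 h4 k
    have h0 : (0 : ℝ) < 1 - ‖q‖ := by linarith
    have hcy : qPochInf (c y) q ≠ 0 := norm_pos_iff.1 (lt_trans (by positivity) h4)
    rw [norm_mul, norm_mul (gauss q k), ← mul_assoc, norm_pow, norm_pow, Complex.norm_real,
      Real.norm_of_nonneg (by positivity)]
    gcongr
    refine (norm_confCoeff_le hq1 (a y) hcy k).trans ?_
    gcongr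

/-! ### Partial fractions -/

open Polynomial in
/-- Partial fractions of a rational function with simple poles at the `1/cᵢ`. -/
lemma eval_div_prod_eq_sum {ι : Type*} [DecidableEq ι] {s : Finset ι} {c : ι → ℂ}
    (hc : ∀ i ∈ s, c i ≠ 0) (hinj : Set.InjOn c s) {P : ℂ[X]} (hP : P.degree < s.card) {t : ℂ}
    (ht : ∀ i ∈ s, 1 - c i * t ≠ 0) :
    P.eval t / ∏ i ∈ s, (1 - c i * t) =
      ∑ i ∈ s, P.eval (c i)⁻¹ / (∏ j ∈ s.erase i, (1 - c j / c i)) / (1 - c i * t) := by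
  have hv : Set.InjOn (fun i => (c i)⁻¹) s := fun i hi j hj h => hinj hi hj (inv_injective h)
  have h := Lagrange.eq_interpolate hv hP
  conv_lhs => rw [h]
  rw [Lagrange.interpolate_apply, eval_finsetSum, Finset.sum_div]
  refine Finset.sum_congr rfl fun i hi => ?_
  rw [eval_mul, eval_C, Lagrange.basis, eval_prod]
  have hb : ∏ j ∈ s.erase i, eval t (Lagrange.basisDivisor (c i)⁻¹ (c j)⁻¹) =
      ∏ j ∈ s.erase i, ((1 - c j * t) / (1 - c j / c i)) := by
    refine Finset.prod_congr rfl fun j hj => ?_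
    have hij := Finset.mem_erase.1 hj
    have h1 := hc i hi
    have h2 := hc j hij.2
    have h3 : c i - c j ≠ 0 := fun h => hij.1 (hinj hij.2 hi (sub_eq_zero.1 h).symm)
    have h4 : c j - c i ≠ 0 := fun h => h3 (by linear_combination -h)
    rw [Lagrange.basisDivisor, eval_mul, eval_C, eval_sub, eval_X, eval_C]
    rw [show (c i)⁻¹ - (c j)⁻¹ = (c j - c i) / (c i * c j) by field_simp,
      show 1 - c j / c i = (c i - c j) / c i by field_simp, inv_div, div_div_eq_mul_div,
      eq_div_iff h3, div_mul_eq_mul_div, div_mul_eq_mul_div, div_eq_iff h4]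
    field_simp
    ring
  rw [hb, Finset.prod_div_distrib, ← Finset.mul_prod_erase s _ hi]
  have h1 : ∏ j ∈ s.erase i, (1 - c j * t) ≠ 0 :=
    Finset.prod_ne_zero_iff.2 fun j hj => ht j (Finset.mem_of_mem_erase hj)
  have h2 := ht i hi
  generalize ∏ j ∈ s.erase i, (1 - c j * t) = p at *
  field_simp

/-- Reversal of the order of the factors in `(xq^(-k);q)_k`. -/
lemma qPoch_div_pow {q : ℂ} (hq : q ≠ 0) {x : ℂ} (hx : x ≠ 0) (k : ℕ) :
    qPoch (x / q ^ k) q k = qPoch (q / x) q k * (-x) ^ k / gauss q (k + 1) := by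
  induction k with
  | zero => simp [qPoch_zero, gauss]
  | succ k ih =>
    have hk : q ^ k ≠ 0 := pow_ne_zero _ hq
    rw [add_comm k 1, qPoch_add, add_comm 1 k, pow_one, pow_succ,
      show x / (q ^ k * q) * q = x / q ^ k by field_simp, ih, qPoch_succ (q / x)]
    push_cast
    rw [gauss_succ hq (k + 1), zpow_add_one₀ hq, zpow_natCast]
    have := gauss_ne_zero hq (k + 1)
    simp only [qPoch, Finset.prod_range_one, pow_zero, mul_one, pow_succ]
    field_simp
    ring

/-- The weight of the pole at `t = 1/(Aqᵏ)` in the partial fraction expansion of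
`(qt;q)_N/((At;q)_N(Bt;q)_N)`. -/
noncomputable def poleWeight (A B q : ℂ) (N k : ℕ) : ℂ :=
  confCoeff A (A * q / B) q k * (q ^ 2 / B) ^ k *
    (qPoch (q / A) q (N - k) / (qPoch q q (N - 1 - k) * qPoch (B / A) q (N - k)))

/-- The coefficient of Lagrange interpolation at the node `1/(Aqᵏ)`. The condition `j = k` singles
out the factor of the denominator that vanishes there. -/
lemma eval_div_erase_eq_poleWeight {A B q : ℂ} (hq : q ≠ 0) (hA : A ≠ 0) (hB : B ≠ 0) {N k : ℕ}
    (hk : k < N) :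
    qPoch (q * (A * q ^ k)⁻¹) q N / ((∏ j ∈ Finset.range N,
      if j = k then 1 else (1 - A * q ^ j / (A * q ^ k))) *
      ∏ j ∈ Finset.range N, (1 - B * q ^ j / (A * q ^ k))) = poleWeight A B q N k := by
  obtain ⟨M, rfl⟩ : ∃ M, N = k + 1 + M := ⟨N - k - 1, by omega⟩
  have hqk : q ^ k ≠ 0 := pow_ne_zero _ hq
  have d1 : (∏ j ∈ Finset.range (k + 1 + M),
      if j = k then 1 else (1 - A * q ^ j / (A * q ^ k))) =
      qPoch (1 / q ^ k) q k * qPoch q q M := by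
    rw [Finset.prod_range_add, Finset.prod_range_succ, if_pos rfl, mul_one, qPoch, qPoch]
    congr 1
    · refine Finset.prod_congr rfl fun j hj => ?_
      rw [if_neg (Finset.mem_range.1 hj).ne]
      field_simp
    · refine Finset.prod_congr rfl fun j _ => ?_
      rw [if_neg (by omega), pow_add, pow_succ]
      field_simp
  have d2 : ∏ j ∈ Finset.range (k + 1 + M), (1 - B * q ^ j / (A * q ^ k)) =
      qPoch (B / A / q ^ k) q (k + (M + 1)) := by
    rw [qPoch, show k + (M + 1) = k + 1 + M by ring]
    refine Finset.prod_congr rfl fun j _ => ?_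
    field_simp
  have d3 : qPoch (q * (A * q ^ k)⁻¹) q (k + 1 + M) = qPoch (q / A / q ^ k) q (k + (M + 1)) := by
    rw [show k + (M + 1) = k + 1 + M by ring]
    congr 1
    field_simp
  rw [d1, d2, d3, qPoch_add _ q k (M + 1), qPoch_add _ q k (M + 1), div_mul_cancel₀ _ hqk,
    div_mul_cancel₀ _ hqk,
    qPoch_div_pow hq (div_ne_zero hq hA), qPoch_div_pow hq (div_ne_zero hB hA),
    qPoch_div_pow hq one_ne_zero, poleWeight, confCoeff, show k + 1 + M - k = M + 1 by omega,
    show k + 1 + M - 1 - k = M by omega, gauss_succ hq, zpow_natCast, div_one, div_div_cancel₀ hq,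
    show q / (B / A) = A * q / B by field_simp]
  generalize qPoch (A * q / B) q k = p1
  generalize qPoch (B / A) q (M + 1) = p2
  generalize qPoch q q k = p3
  generalize qPoch q q M = p4
  have := gauss_ne_zero hq k
  have e : (-(q / A)) ^ k = (-1) ^ k * (q ^ k * (A ^ k)⁻¹) := by rw [neg_pow, div_pow]; rfl
  have e' : (-(B / A)) ^ k = (-1) ^ k * (B ^ k * (A ^ k)⁻¹) := by rw [neg_pow, div_pow]; rfl
  have hAk : A ^ k ≠ 0 := pow_ne_zero _ hA
  have hBk : B ^ k ≠ 0 := pow_ne_zero _ hB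
  have h1 : ((-1 : ℂ) ^ k) ≠ 0 := pow_ne_zero _ (by norm_num)
  have h2 : ((-1 : ℂ) ^ k) * (-1) ^ k = 1 := by rw [← mul_pow]; norm_num
  rw [e, e', div_pow, ← pow_mul, mul_comm 2 k, pow_mul]
  generalize (-1 : ℂ) ^ k = ε at *
  rw [show ε = ε⁻¹ from eq_inv_of_mul_eq_one_left h2]
  simp only [div_eq_mul_inv, mul_inv, inv_inv]
  field_simp
  rw [sq, h2, mul_one]

open Polynomial in
lemma exists_polynomial_qPoch (q : ℂ) {N : ℕ} :
    ∃ P : ℂ[X], P.natDegree ≤ N ∧ ∀ t, P.eval t = qPoch (q * t) q N := by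
  refine ⟨∏ k ∈ Finset.range N, (1 - C (q * q ^ k) * X), ?_, fun t => ?_⟩
  · refine (natDegree_prod_le _ _).trans ((Finset.sum_le_card_nsmul _ _ 1 fun k _ => ?_).trans ?_)
    · compute_degree
    · simp
  · rw [eval_prod, qPoch]
    refine Finset.prod_congr rfl fun k _ => ?_
    simp only [eval_sub, eval_one, eval_mul, eval_C, eval_X]
    ring

lemma mul_zpow_ne_symm {q : ℂ} (hq : q ≠ 0) {A B : ℂ} (hAB : ∀ n : ℤ, A * q ^ n ≠ B) (n : ℤ) :
    B * q ^ n ≠ A := by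
  intro h
  refine hAB (-n) ?_
  rw [← h, mul_assoc, ← zpow_add₀ hq]
  simp

/-- Partial fractions of `(qt;q)_N/((At;q)_N(Bt;q)_N)`: non-resonance of `A` and `B` makes all the
poles simple. -/
lemma qPoch_div_eq_sum {A B q : ℂ} (hq : q ≠ 0) (hq1 : ‖q‖ < 1) (hA : A ≠ 0) (hB : B ≠ 0)
    (hAB : ∀ n : ℤ, A * q ^ n ≠ B) {t : ℂ} (hAt : qPochInf (A * t) q ≠ 0)
    (hBt : qPochInf (B * t) q ≠ 0) {N : ℕ} (hN : 0 < N) :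
    qPoch (q * t) q N / (qPoch (A * t) q N * qPoch (B * t) q N) =
      ∑ k ∈ Finset.range N, poleWeight A B q N k / (1 - A * q ^ k * t) +
      ∑ k ∈ Finset.range N, poleWeight B A q N k / (1 - B * q ^ k * t) := by
  obtain ⟨P, hdeg, hP⟩ := exists_polynomial_qPoch q (N := N)
  have hpow : ∀ (x : ℂ), x ≠ 0 → Function.Injective fun k : ℕ => x * q ^ k := by
    intro x hx i j h
    have h1 := congrArg norm (mul_left_cancel₀ hx h)
    rw [norm_pow, norm_pow] at h1
    exact pow_right_injective₀ (norm_pos_iff.2 hq) hq1.ne h1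
  have hcross : ∀ i j : ℕ, A * q ^ i ≠ B * q ^ j := by
    intro i j h
    refine hAB (i - j) ?_
    have : q ^ j ≠ 0 := pow_ne_zero _ hq
    rw [zpow_sub₀ hq, zpow_natCast, zpow_natCast, mul_div_assoc', h, mul_div_cancel_right₀ _ this]
  have hnz : ∀ x : ℂ, qPochInf (x * t) q ≠ 0 → ∀ k : ℕ, 1 - x * q ^ k * t ≠ 0 := by
    intro x hx k h
    exact hx ((qPochInf_eq_zero_iff hq1 _).2 ⟨k, by linear_combination -h⟩)
  let s : Finset (ℕ ⊕ ℕ) := (Finset.range N).disjSum (Finset.range N)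
  let c : ℕ ⊕ ℕ → ℂ := Sum.elim (fun k => A * q ^ k) fun k => B * q ^ k
  have h := eval_div_prod_eq_sum (s := s) (c := c) (P := P) (t := t)
    (by rintro (i | i) _ <;> exact mul_ne_zero (by assumption) (pow_ne_zero _ hq))
    (by
      rintro (i | i) _ (j | j) _ hij
      · exact congrArg _ (hpow A hA hij)
      · exact absurd hij (hcross i j)
      · exact absurd hij.symm (hcross j i)
      · exact congrArg _ (hpow B hB hij))
    (by
      refine Polynomial.degree_le_natDegree.trans_lt ?_
      rw [Finset.card_disjSum, Finset.card_range]
      exact_mod_cast (by omega : P.natDegree < N + N))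
    (by
      rintro (i | i) _
      · exact hnz A hAt i
      · exact hnz B hBt i)
  have herase : ∀ i ∈ s, ∏ j ∈ s.erase i, (1 - c j / c i) =
      ∏ j ∈ s, if j = i then 1 else (1 - c j / c i) := by
    intro i hi
    rw [← Finset.mul_prod_erase s _ hi, if_pos rfl, one_mul]
    exact Finset.prod_congr rfl fun j hj => by rw [if_neg (Finset.ne_of_mem_erase hj)]
  rw [Finset.sum_congr rfl fun i hi => by rw [herase i hi]] at h
  simp only [hP, s, c, Finset.prod_disjSum, Finset.sum_disjSum, Sum.elim_inl, Sum.elim_inr,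
    Sum.inl.injEq, Sum.inr.injEq, reduceCtorEq, if_false] at h
  have hq' : ∀ x : ℂ, ∏ k ∈ Finset.range N, (1 - x * q ^ k * t) = qPoch (x * t) q N := by
    intro x
    rw [qPoch]
    exact Finset.prod_congr rfl fun k _ => by ring
  rw [hq', hq'] at h
  rw [h]
  congr 1
  · refine Finset.sum_congr rfl fun k hk => ?_
    rw [eval_div_erase_eq_poleWeight hq hA hB (Finset.mem_range.1 hk)]
  · refine Finset.sum_congr rfl fun k hk => ?_
    rw [mul_comm (∏ j ∈ Finset.range N, (1 - A * q ^ j / (B * q ^ k))),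
      eval_div_erase_eq_poleWeight hq hB hA (Finset.mem_range.1 hk)]

lemma qPochInf_div_ne_zero {A B q : ℂ} (hq1 : ‖q‖ < 1) (hA : A ≠ 0)
    (hBA : ∀ n : ℤ, B * q ^ n ≠ A) : qPochInf (B / A) q ≠ 0 := by
  rw [Ne, qPochInf_eq_zero_iff hq1]
  rintro ⟨k, hk⟩
  refine hBA k ?_
  rw [zpow_natCast]
  field_simp at hk
  exact hk

lemma qPochInf_mul_div_ne_zero {A B q : ℂ} (hq : q ≠ 0) (hq1 : ‖q‖ < 1) (hB : B ≠ 0)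
    (hAB : ∀ n : ℤ, A * q ^ n ≠ B) : qPochInf (A * q / B) q ≠ 0 := by
  rw [Ne, qPochInf_eq_zero_iff hq1]
  rintro ⟨k, hk⟩
  refine hAB (k + 1) ?_
  rw [zpow_add₀ hq, zpow_natCast, zpow_one]
  field_simp at hk
  linear_combination hk

/-- The limit `N → ∞` of one family of partial fractions, by dominated convergence. -/
lemma tendsto_sum_poleWeight {A B q : ℂ} (hq : q ≠ 0) (hq1 : ‖q‖ < 1) (hA : A ≠ 0) (hB : B ≠ 0)
    (hAB : ∀ n : ℤ, A * q ^ n ≠ B) {t : ℂ} (ht : t ≠ 0) :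
    Tendsto (fun N => ∑ k ∈ Finset.range N, poleWeight A B q N k / (1 - A * q ^ k * t)) atTop
      (𝓝 (∑' k : ℕ, qPochInf (q / A) q / (qPochInf q q * qPochInf (B / A) q) *
        (confCoeff A (A * q / B) q k * (q ^ 2 / B) ^ k / (1 - A * q ^ k * t)))) := by
  have hE := qPochInf_self_ne_zero hq1
  have hBA : qPochInf (B / A) q ≠ 0 := qPochInf_div_ne_zero hq1 hA (mul_zpow_ne_symm hq hAB)
  have hC : qPochInf (A * q / B) q ≠ 0 := qPochInf_mul_div_ne_zero hq hq1 hB hAB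
  obtain ⟨C, hC0, hC1, -⟩ := exists_bound_kronecker hq1 (mul_ne_zero hA ht)
  have hsum : ∀ N, ∑ k ∈ Finset.range N, poleWeight A B q N k / (1 - A * q ^ k * t) =
      ∑' k, if k < N then poleWeight A B q N k / (1 - A * q ^ k * t) else 0 := by
    intro N
    rw [tsum_eq_sum (s := Finset.range N) fun k hk => if_neg (by simpa using hk)]
    exact Finset.sum_congr rfl fun k hk => (if_pos (Finset.mem_range.1 hk)).symm
  simp only [hsum]
  set D := Real.exp (‖q / A‖ / (1 - ‖q‖)) * (Real.exp (‖q‖ / (1 - ‖q‖)) / ‖qPochInf q q‖) *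
    (Real.exp (‖B / A‖ / (1 - ‖q‖)) / ‖qPochInf (B / A) q‖) with hDdef
  have hD : 0 ≤ D := by positivity
  refine tendsto_tsum_of_dominated_convergence
    ((summable_conf hq hq1 A hC (q ^ 2 / B)).mul_right (D * C)) (fun k => ?_)
    (Eventually.of_forall fun N k => ?_)
  · have t1 : Tendsto (fun N => qPoch (q / A) q (N - k)) atTop (𝓝 (qPochInf (q / A) q)) :=
      (tendsto_qPoch hq1 _).comp (tendsto_sub_atTop_nat k)
    have t2 : Tendsto (fun N => qPoch (B / A) q (N - k)) atTop (𝓝 (qPochInf (B / A) q)) :=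
      (tendsto_qPoch hq1 _).comp (tendsto_sub_atTop_nat k)
    have t3 : Tendsto (fun N => qPoch q q (N - 1 - k)) atTop (𝓝 (qPochInf q q)) := by
      simp only [Nat.sub_sub]
      exact (tendsto_qPoch hq1 _).comp (tendsto_sub_atTop_nat (1 + k))
    have t4 := (((t1.div (t3.mul t2) (mul_ne_zero hE hBA)).const_mul
      (confCoeff A (A * q / B) q k * (q ^ 2 / B) ^ k)).div_const (1 - A * q ^ k * t))
    refine (t4.congr' ?_).trans_eq ?_
    · filter_upwards [eventually_gt_atTop k] with N hN
      rw [if_pos hN]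
      rfl
    · congr 1
      ring
  · split_ifs
    · have e : poleWeight A B q N k / (1 - A * q ^ k * t) =
          (confCoeff A (A * q / B) q k * (q ^ 2 / B) ^ k) *
          (qPoch (q / A) q (N - k) * (qPoch q q (N - 1 - k))⁻¹ * (qPoch (B / A) q (N - k))⁻¹ *
            (1 - A * t * q ^ k)⁻¹) := by
        rw [poleWeight, div_eq_mul_inv, div_eq_mul_inv (qPoch (q / A) q (N - k)), mul_inv]
        ring
      rw [e, norm_mul]
      refine mul_le_mul_of_nonneg_left ?_ (norm_nonneg _)
      rw [norm_mul, norm_mul, norm_mul, hDdef]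
      gcongr
      · exact norm_qPoch_le hq1 _ _
      · exact norm_inv_qPoch_le hq1 hE _
      · exact norm_inv_qPoch_le hq1 hBA _
      · exact hC1 k
    · rw [norm_zero]
      positivity

/-- Partial fractions of `(qt;q)_∞/((At;q)_∞(Bt;q)_∞)`. -/
lemma qPochInf_div_eq_tsum {A B q : ℂ} (hq : q ≠ 0) (hq1 : ‖q‖ < 1) (hA : A ≠ 0) (hB : B ≠ 0)
    (hAB : ∀ n : ℤ, A * q ^ n ≠ B) {t : ℂ} (ht : t ≠ 0) (hAt : qPochInf (A * t) q ≠ 0)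
    (hBt : qPochInf (B * t) q ≠ 0) :
    qPochInf (q * t) q / (qPochInf (A * t) q * qPochInf (B * t) q) =
      (∑' k : ℕ, qPochInf (q / A) q / (qPochInf q q * qPochInf (B / A) q) *
        (confCoeff A (A * q / B) q k * (q ^ 2 / B) ^ k / (1 - A * q ^ k * t))) +
      ∑' k : ℕ, qPochInf (q / B) q / (qPochInf q q * qPochInf (A / B) q) *
        (confCoeff B (B * q / A) q k * (q ^ 2 / A) ^ k / (1 - B * q ^ k * t)) := by
  have t1 := (tendsto_qPoch hq1 (q * t)).div ((tendsto_qPoch hq1 (A * t)).mul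
    (tendsto_qPoch hq1 (B * t))) (mul_ne_zero hAt hBt)
  have t2 := (tendsto_sum_poleWeight hq hq1 hA hB hAB ht).add
    (tendsto_sum_poleWeight hq hq1 hB hA (mul_zpow_ne_symm hq hAB) ht)
  refine tendsto_nhds_unique t1 (t2.congr' ?_)
  filter_upwards [eventually_gt_atTop 0] with N hN
  exact (qPoch_div_eq_sum hq hq1 hA hB hAB hAt hBt hN).symm

/-! ### The connection formula inside an annulus -/

/-- The zeros of a nonzero holomorphic function on `ℂ*` are isolated. -/
lemma eventually_ne_zero_of_differentiableOn {f : ℂ → ℂ} (hf : DifferentiableOn ℂ f {0}ᶜ)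
    {x₁ x : ℂ} (h₁ : x₁ ≠ 0) (hx₁ : f x₁ ≠ 0) (hx : x ≠ 0) : ∀ᶠ y in 𝓝[≠] x, f y ≠ 0 := by
  by_contra h
  have hU : IsPreconnected ({0}ᶜ : Set ℂ) :=
    (isConnected_compl_singleton_of_one_lt_rank (by simp) (0 : ℂ)).isPreconnected
  exact hx₁ ((hf.analyticOnNhd
    isOpen_compl_singleton).eqOn_zero_of_preconnected_of_frequently_eq_zero hU hx (z₀ := x) h h₁)

lemma eqOn_of_eventuallyEq {f g : ℂ → ℂ} (hf : DifferentiableOn ℂ f {0}ᶜ)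
    (hg : DifferentiableOn ℂ g {0}ᶜ) {x : ℂ} (hx : x ≠ 0) (h : f =ᶠ[𝓝 x] g) {y : ℂ} (hy : y ≠ 0) :
    f y = g y :=
  (hf.analyticOnNhd isOpen_compl_singleton).eqOn_of_preconnected_of_eventuallyEq
    (hg.analyticOnNhd isOpen_compl_singleton)
    (isConnected_compl_singleton_of_one_lt_rank (by simp) (0 : ℂ)).isPreconnected hx h hy

lemma theta_neg_ne_zero_iff {q : ℂ} (hq : q ≠ 0) (hq1 : ‖q‖ < 1) {x : ℂ} (hx : x ≠ 0) :
    theta q (-x) ≠ 0 ↔ ∀ n : ℤ, x * q ^ n ≠ 1 := by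
  rw [Ne, theta_eq_zero_iff hq hq1 (neg_ne_zero.2 hx)]
  push Not
  constructor
  · intro h n hn
    refine h (-n) ?_
    rw [zpow_neg, neg_inj]
    exact eq_inv_of_mul_eq_one_left hn
  · intro h n hn
    refine h (-n) ?_
    rw [neg_inj.1 hn, ← zpow_add₀ hq]
    simp

lemma theta_neg_div_ne_zero_iff {q : ℂ} (hq : q ≠ 0) (hq1 : ‖q‖ < 1) {A B : ℂ} (hA : A ≠ 0)
    (hB : B ≠ 0) : theta q (-(A / B)) ≠ 0 ↔ ∀ n : ℤ, A * q ^ n ≠ B := by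
  rw [theta_neg_ne_zero_iff hq hq1 (div_ne_zero hA hB)]
  refine forall_congr' fun n => not_congr ?_
  rw [div_mul_eq_mul_div, div_eq_one_iff_eq hB]

/-- The sum of the series `₂φ₁(A, B; 0; q, z)`, meaningful for `|z| < 1`. -/
noncomputable def phiZero (A B q z : ℂ) : ℂ :=
  ∑' n : ℕ, qPoch A q n * qPoch B q n / qPoch q q n * z ^ n

lemma phiZero_comm (A B q z : ℂ) : phiZero A B q z = phiZero B A q z := by
  simp only [phiZero, mul_comm (qPoch A q _)]

/-- The contribution of the exponent attached to `A` to `θ(-z) ₂φ₁(A, B; 0; q, z)` at infinity. -/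
noncomputable def halfConn (A B q z : ℂ) : ℂ :=
  qPochInf B q / qPochInf (B / A) q * theta q (-(A * z)) * conf A (A * q / B) q (q ^ 2 / (B * z))

/-- Summing a single family of simple fractions against `zⁿ` gives a Kronecker sum times a confluent
series. -/
lemma hasSum_mul_tsum_partial_fraction {A B q z : ℂ} (hq : q ≠ 0) (hq1 : ‖q‖ < 1) (hA : A ≠ 0)
    (hB : B ≠ 0) (hAB : ∀ n : ℤ, A * q ^ n ≠ B) (hqz : ‖q‖ < ‖z‖) (hz : ‖z‖ < 1) (κ : ℂ) :
    HasSum (fun n : ℤ => z ^ n * ∑' k : ℕ, κ *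
        (confCoeff A (A * q / B) q k * (q ^ 2 / B) ^ k / (1 - A * q ^ k * q ^ n)))
      (κ * conf A (A * q / B) q (q ^ 2 / (B * z)) * ∑' j : ℤ, z ^ j / (1 - A * q ^ j)) := by
  have hz0 : z ≠ 0 := norm_pos_iff.1 ((norm_nonneg q).trans_lt hqz)
  have h := (hasSum_shear (fun k : ℕ => (k : ℤ))
    (summable_conf hq hq1 A (qPochInf_mul_div_ne_zero hq hq1 hB hAB) (q ^ 2 / (B * z)))
    (summable_kronecker hq hq1 hA hqz hz)).mul_left κ
  rw [← mul_assoc] at h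
  refine Eq.mpr (congrArg (HasSum · _) (funext fun n => ?_)) h
  rw [← tsum_mul_left, ← tsum_mul_left]
  refine tsum_congr fun k => ?_
  have : z ^ k ≠ 0 := pow_ne_zero _ hz0
  rw [zpow_add₀ hz0, zpow_natCast, zpow_add₀ hq, zpow_natCast, ← div_div, div_pow _ z,
    mul_comm (q ^ n), ← mul_assoc A]
  field_simp

lemma qPochInf_ne_zero_of_mul_zpow_ne {A q : ℂ} (hq1 : ‖q‖ < 1) (h : ∀ n : ℤ, A * q ^ n ≠ 1) :
    qPochInf A q ≠ 0 := by
  rw [Ne, qPochInf_eq_zero_iff hq1]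
  rintro ⟨k, hk⟩
  exact h k (by rwa [zpow_natCast])

/-- The bilateral series obtained from `₂φ₁(A, B; 0; q, z)` by writing its coefficients as values of
`(qt;q)_∞/((At;q)_∞(Bt;q)_∞)` at `t = qⁿ`; the terms with `n < 0` vanish. -/
lemma tsum_bilateral_eq_phiZero {A B q z : ℂ} (hq : q ≠ 0) (hq1 : ‖q‖ < 1)
    (hA : qPochInf A q ≠ 0) (hB : qPochInf B q ≠ 0) :
    ∑' n : ℤ, z ^ n * (qPochInf (q * q ^ n) q /
        (qPochInf (A * q ^ n) q * qPochInf (B * q ^ n) q)) =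
      qPochInf q q / (qPochInf A q * qPochInf B q) * phiZero A B q z := by
  rw [← (Nat.cast_injective (R := ℤ)).tsum_eq, phiZero, ← tsum_mul_left]
  · refine tsum_congr fun n => ?_
    have h1 := qPochInf_eq_mul hq1 A n
    have h2 := qPochInf_eq_mul hq1 B n
    have h3 := qPochInf_eq_mul hq1 q n
    have h4 := qPoch_ne_zero hq1 (qPochInf_self_ne_zero hq1) n
    rw [h1] at hA
    rw [h2] at hB
    have hA1 := left_ne_zero_of_mul hA
    have hA2 := right_ne_zero_of_mul hA
    have hB1 := left_ne_zero_of_mul hB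
    have hB2 := right_ne_zero_of_mul hB
    rw [zpow_natCast, zpow_natCast, h1, h2, h3]
    field_simp
  · intro n hn
    by_contra h
    have hn' : n < 0 := by
      by_contra! h0
      exact h ⟨n.toNat, by simp [h0]⟩
    refine hn ?_
    have : qPochInf (q * q ^ n) q = 0 := by
      rw [qPochInf_eq_zero_iff hq1]
      refine ⟨(-(n + 1)).toNat, ?_⟩
      rw [← zpow_natCast, Int.toNat_of_nonneg (by omega), ← zpow_one_add₀ hq, ← zpow_add₀ hq,
        show 1 + n + -(n + 1) = 0 by ring, zpow_zero]
    simp [this]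

/-- The connection formula in the annulus `|q| < |z| < 1`, for `A` and `B` off the spiral `[1;q]`:
then the poles in `t` of the partial fractions avoid the points `t = qⁿ`. -/
lemma theta_mul_phiZero_of_generic {A B q z : ℂ} (hq : q ≠ 0) (hq1 : ‖q‖ < 1) (hA : A ≠ 0)
    (hB : B ≠ 0) (hAB : ∀ n : ℤ, A * q ^ n ≠ B) (hA1 : ∀ n : ℤ, A * q ^ n ≠ 1)
    (hB1 : ∀ n : ℤ, B * q ^ n ≠ 1) (hqz : ‖q‖ < ‖z‖) (hz : ‖z‖ < 1) :
    theta q (-z) * phiZero A B q z = halfConn A B q z + halfConn B A q z := by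
  have hBA := mul_zpow_ne_symm hq hAB
  have key : ∀ A : ℂ, (∀ n : ℤ, A * q ^ n ≠ 1) → ∀ n : ℤ, qPochInf (A * q ^ n) q ≠ 0 := by
    intro A hA n
    refine qPochInf_ne_zero_of_mul_zpow_ne hq1 fun k => ?_
    rw [mul_assoc, ← zpow_add₀ hq]
    exact hA _
  have hEA : qPochInf A q ≠ 0 := qPochInf_ne_zero_of_mul_zpow_ne hq1 hA1
  have hEB : qPochInf B q ≠ 0 := qPochInf_ne_zero_of_mul_zpow_ne hq1 hB1
  have hS := ((hasSum_mul_tsum_partial_fraction hq hq1 hA hB hAB hqz hz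
    (qPochInf (q / A) q / (qPochInf q q * qPochInf (B / A) q))).add
    (hasSum_mul_tsum_partial_fraction hq hq1 hB hA hBA hqz hz
      (qPochInf (q / B) q / (qPochInf q q * qPochInf (A / B) q)))).tsum_eq
  simp only [← mul_add] at hS
  simp only [← qPochInf_div_eq_tsum hq hq1 hA hB hAB (zpow_ne_zero _ hq) (key A hA1 _)
    (key B hB1 _)] at hS
  rw [tsum_bilateral_eq_phiZero hq hq1 hEA hEB] at hS
  have kA := theta_mul_kronecker hq hq1 hA hA1 hqz hz
  have kB := theta_mul_kronecker hq hq1 hB hB1 hqz hz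
  have tA := theta_eq_prod hq hq1 (neg_ne_zero.2 hA)
  have tB := theta_eq_prod hq hq1 (neg_ne_zero.2 hB)
  have hθA := (theta_neg_ne_zero_iff hq hq1 hA).2 hA1
  have hθB := (theta_neg_ne_zero_iff hq hq1 hB).2 hB1
  rw [neg_neg, show -(q / -A) = q / A by rw [div_neg, neg_neg]] at tA
  rw [neg_neg, show -(q / -B) = q / B by rw [div_neg, neg_neg]] at tB
  rw [tA] at hθA kA
  rw [tB] at hθB kB
  have hE := qPochInf_self_ne_zero hq1
  have eA := right_ne_zero_of_mul hθA
  have eB := right_ne_zero_of_mul hθB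
  have e1 : qPochInf (B / A) q ≠ 0 := qPochInf_div_ne_zero hq1 hA hBA
  have e2 : qPochInf (A / B) q ≠ 0 := qPochInf_div_ne_zero hq1 hB hAB
  rw [halfConn, halfConn]
  generalize (∑' j : ℤ, z ^ j / (1 - A * q ^ j)) = KA at *
  generalize (∑' j : ℤ, z ^ j / (1 - B * q ^ j)) = KB at *
  have hS' : phiZero A B q z = qPochInf A q * qPochInf B q / qPochInf q q *
      (qPochInf (q / A) q / (qPochInf q q * qPochInf (B / A) q) *
        conf A (A * q / B) q (q ^ 2 / (B * z)) * KA +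
      qPochInf (q / B) q / (qPochInf q q * qPochInf (A / B) q) *
        conf B (B * q / A) q (q ^ 2 / (A * z)) * KB) := by
    rw [← hS]
    field_simp
  have split : ∀ c u v : ℂ, theta q (-z) * (c * (u * KA + v * KB)) =
      c * u * (theta q (-z) * KA) + c * v * (theta q (-z) * KB) := by
    intro c u v; ring
  rw [hS', split, kA, kB]
  congr 1 <;> field_simp

lemma continuousAt_phiZero {q z B : ℂ} (hq1 : ‖q‖ < 1) (hz : ‖z‖ < 1) (A : ℂ) :
    ContinuousAt (fun A => phiZero A B q z) A := by
  have hE := qPochInf_self_ne_zero hq1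
  have h0 : (0 : ℝ) < 1 - ‖q‖ := by linarith
  have e1 := (continuousAt_id (x := A)).norm.eventually_lt_const (lt_add_one ‖A‖)
  refine tendsto_tsum_of_dominated_convergence
    (bound := fun n : ℕ => Real.exp ((‖A‖ + 1) / (1 - ‖q‖)) * Real.exp (‖B‖ / (1 - ‖q‖)) *
      (Real.exp (‖q‖ / (1 - ‖q‖)) / ‖qPochInf q q‖) * ‖z‖ ^ n)
    ((summable_geometric_of_lt_one (norm_nonneg z) hz).mul_left _) (fun k => ?_) ?_
  · have : ContinuousAt (fun A => qPoch A q k) A := by unfold qPoch; fun_prop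
    exact (((this.mul continuousAt_const).div_const _).mul continuousAt_const).tendsto
  · filter_upwards [e1] with y hy k
    rw [div_eq_mul_inv, norm_mul, norm_mul, norm_mul, norm_pow]
    gcongr
    · refine (norm_qPoch_le hq1 _ _).trans ?_
      gcongr
      exact hy.le
    · exact norm_qPoch_le hq1 _ _
    · exact norm_inv_qPoch_le hq1 hE _

lemma continuousAt_halfConn {q z : ℂ} (hq : q ≠ 0) (hq1 : ‖q‖ < 1) (hz : z ≠ 0)
    {a b : ℂ → ℂ} {x : ℂ}
    (ha : ContinuousAt a x) (hb : ContinuousAt b x) (hax : a x ≠ 0) (hbx : b x ≠ 0)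
    (hab : ∀ n : ℤ, a x * q ^ n ≠ b x) : ContinuousAt (fun y => halfConn (a y) (b y) q z) x := by
  have hE : Continuous fun u => qPochInf u q := (differentiable_qPochInf hq hq1).continuous
  have e1 : qPochInf (b x / a x) q ≠ 0 := qPochInf_div_ne_zero hq1 hax (mul_zpow_ne_symm hq hab)
  refine ((((hE.continuousAt.comp hb).div (hE.continuousAt.comp (hb.div ha hax)) e1)).mul
    (ContinuousAt.comp (g := theta q) ?_ (ha.mul continuousAt_const).neg)).mul
    (continuousAt_conf hq hq1 ha ((ha.mul continuousAt_const).div hb hbx)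
      (continuousAt_const.div (hb.mul continuousAt_const) (mul_ne_zero hbx hz))
      (qPochInf_mul_div_ne_zero hq hq1 hbx hab))
  exact (differentiableAt_theta hq hq1 (neg_ne_zero.2 (mul_ne_zero hax hz))).continuousAt

/-- The connection formula in the annulus `|q| < |z| < 1`. The excluded case that `A` or `B` lies on
the spiral `[1;q]` follows from the generic one by continuity. -/
lemma theta_mul_phiZero {A B q z : ℂ} (hq : q ≠ 0) (hq1 : ‖q‖ < 1) (hA : A ≠ 0)
    (hB : B ≠ 0) (hAB : ∀ n : ℤ, A * q ^ n ≠ B) (hqz : ‖q‖ < ‖z‖) (hz : ‖z‖ < 1) :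
    theta q (-z) * phiZero A B q z = halfConn A B q z + halfConn B A q z := by
  have hz0 : z ≠ 0 := norm_pos_iff.1 ((norm_nonneg q).trans_lt hqz)
  have main : ∀ A B : ℂ, A ≠ 0 → B ≠ 0 → (∀ n : ℤ, A * q ^ n ≠ B) → (∀ n : ℤ, B * q ^ n ≠ 1) →
      theta q (-z) * phiZero A B q z = halfConn A B q z + halfConn B A q z := by
    intro A B hA hB hAB hB1
    have t1 : ContinuousAt (fun A => theta q (-z) * phiZero A B q z) A :=
      continuousAt_const.mul (continuousAt_phiZero hq1 hz A)
    have t2 : ContinuousAt (fun A => halfConn A B q z + halfConn B A q z) A :=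
      (continuousAt_halfConn hq hq1 hz0 continuousAt_id continuousAt_const hA hB hAB).add
        (continuousAt_halfConn hq hq1 hz0 continuousAt_const continuousAt_id hB hA
          (mul_zpow_ne_symm hq hAB))
    have hd : DifferentiableOn ℂ (fun A => theta q (-A)) {0}ᶜ := fun x hx =>
      ((differentiableAt_theta hq hq1 (neg_ne_zero.2 hx)).comp x
        differentiableAt_id.neg).differentiableWithinAt
    -- parameters `A'` near `A` are generic; the condition is expressed by theta functions
    have g1 : ∀ᶠ A' in 𝓝[≠] A, theta q (-A') ≠ 0 :=
      eventually_ne_zero_of_differentiableOn hd (x₁ := -1) (by simp)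
        (by simpa using theta_one_ne_zero hq hq1) hA
    have g2 : ∀ᶠ A' in 𝓝[≠] A, theta q (-(A' / B)) ≠ 0 := by
      have : ContinuousAt (fun A' => theta q (-(A' / B))) A :=
        ContinuousAt.comp (g := theta q)
          (differentiableAt_theta hq hq1 (neg_ne_zero.2 (div_ne_zero hA hB))).continuousAt
          (continuousAt_id.div_const B).neg
      exact nhdsWithin_le_nhds (this.eventually_ne ((theta_neg_div_ne_zero_iff hq hq1 hA hB).2 hAB))
    have g3 : ∀ᶠ A' in 𝓝[≠] A, A' ≠ 0 := nhdsWithin_le_nhds (continuousAt_id.eventually_ne hA)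
    refine tendsto_nhds_unique (t1.tendsto.mono_left nhdsWithin_le_nhds)
      ((t2.tendsto.mono_left (nhdsWithin_le_nhds (s := {A}ᶜ))).congr' ?_)
    filter_upwards [g1, g2, g3] with A' h1 h2 h3
    exact (theta_mul_phiZero_of_generic hq hq1 h3 hB
      ((theta_neg_div_ne_zero_iff hq hq1 h3 hB).1 h2)
      ((theta_neg_ne_zero_iff hq hq1 h3).1 h1) hB1 hqz hz).symm
  by_cases hB1 : ∀ n : ℤ, B * q ^ n ≠ 1
  · exact main A B hA hB hAB hB1
  -- if `B` is on the spiral `[1;q]`, then `A` is not, and the roles are exchanged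
  · push Not at hB1
    obtain ⟨j, hj⟩ := hB1
    rw [phiZero_comm, add_comm]
    refine main B A hB hA (mul_zpow_ne_symm hq hAB) fun n hn => hAB (n - j) ?_
    rw [zpow_sub₀ hq, mul_div_assoc', hn, ← hj, mul_div_cancel_right₀ _ (zpow_ne_zero j hq)]

/-! ### Meromorphic continuations -/

lemma toMeromorphicNFOn_div_eq {H D : ℂ → ℂ} {U : Set ℂ} {z : ℂ}
    (hH : ∀ z ∈ U, AnalyticAt ℂ H z) (hD : ∀ z ∈ U, AnalyticAt ℂ D z) (hz : z ∈ U) (hDz : D z ≠ 0) :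
    toMeromorphicNFOn (fun z => H z / D z) U z = H z / D z := by
  have hm : MeromorphicOn (fun z => H z / D z) U := fun z hz =>
    (hH z hz).meromorphicAt.div (hD z hz).meromorphicAt
  rw [toMeromorphicNFOn_eq_toMeromorphicNFAt hm hz,
    toMeromorphicNFAt_eq_self.2 (AnalyticAt.meromorphicNFAt
      (f := fun z => H z / D z) ((hH z hz).div (hD z hz) hDz))]

/-- A power series whose sum is a quotient of entire functions has a meromorphic continuation. -/
lemma isMeroCont_div {f : PowerSeries ℂ} {H D : ℂ → ℂ} (hH : Differentiable ℂ H)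
    (hD : Differentiable ℂ D) (hD0 : D 0 ≠ 0)
    (h : ∀ᶠ z in 𝓝 (0 : ℂ), HasSum (fun n : ℕ => PowerSeries.coeff n f * z ^ n) (H z / D z)) :
    IsMeroCont f (toMeromorphicNFOn (fun z => H z / D z) Set.univ) := by
  refine ⟨meromorphicNFOn_toMeromorphicNFOn _ _, ?_⟩
  filter_upwards [h, hD.continuous.continuousAt.eventually_ne hD0] with z h1 h2
  rwa [toMeromorphicNFOn_div_eq (fun z _ => hH.analyticAt z)
    (fun z _ => hD.analyticAt z) (Set.mem_univ z) h2]

/-- Where the denominator does not vanish, the continuation has the value of the quotient. -/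
lemma meroCont_eq_div {f : PowerSeries ℂ} {H D : ℂ → ℂ} (hH : Differentiable ℂ H)
    (hD : Differentiable ℂ D) (hD0 : D 0 ≠ 0)
    (h : ∀ᶠ z in 𝓝 (0 : ℂ), HasSum (fun n : ℕ => PowerSeries.coeff n f * z ^ n) (H z / D z))
    {z : ℂ} (hz : D z ≠ 0) : meroCont f z = H z / D z := by
  have hF := isMeroCont_div hH hD hD0 h
  have hex : ∃ F, IsMeroCont f F := ⟨_, hF⟩
  rw [meroCont, dif_pos hex, hex.choose_spec.unique hF,
    toMeromorphicNFOn_div_eq (fun z _ => hH.analyticAt z)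
    (fun z _ => hD.analyticAt z) (Set.mem_univ z) hz]

/-! ### The continuation of `₂φ₁(A, B; 0; q, z)` -/

lemma summable_phiZero {q : ℂ} (hq1 : ‖q‖ < 1) (A B : ℂ) {r : ℝ} (hr0 : 0 ≤ r) (hr : r < 1) :
    Summable fun n : ℕ => ‖qPoch A q n * qPoch B q n / qPoch q q n‖ * r ^ n := by
  refine Summable.of_nonneg_of_le (fun _ => by positivity) (fun n => ?_)
    ((summable_geometric_of_lt_one hr0 hr).mul_left (Real.exp (‖A‖ / (1 - ‖q‖)) *
      Real.exp (‖B‖ / (1 - ‖q‖)) * (Real.exp (‖q‖ / (1 - ‖q‖)) / ‖qPochInf q q‖)))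
  rw [div_eq_mul_inv, norm_mul, norm_mul]
  gcongr
  · exact norm_qPoch_le hq1 _ _
  · exact norm_qPoch_le hq1 _ _
  · exact norm_inv_qPoch_le hq1 (qPochInf_self_ne_zero hq1) _

lemma hasSum_phiZero {q : ℂ} (hq1 : ‖q‖ < 1) (A B : ℂ) {z : ℂ} (hz : ‖z‖ < 1) :
    HasSum (fun n : ℕ => qPoch A q n * qPoch B q n / qPoch q q n * z ^ n) (phiZero A B q z) := by
  refine Summable.hasSum (Summable.of_norm ?_)
  simpa only [norm_mul, norm_pow] using summable_phiZero hq1 A B (norm_nonneg z) hz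

lemma differentiableOn_phiZero {q : ℂ} (hq1 : ‖q‖ < 1) (A B : ℂ) :
    DifferentiableOn ℂ (phiZero A B q) (Metric.ball 0 1) := by
  intro z hz
  rw [mem_ball_zero_iff] at hz
  obtain ⟨r, hzr, hr⟩ := exists_between hz
  exact ((differentiableOn_tsum_pow (summable_phiZero hq1 A B ((norm_nonneg z).trans hzr.le)
    hr)).differentiableAt (Metric.isOpen_ball.mem_nhds (by simpa using hzr))).differentiableWithinAt

lemma differentiableOn_halfConn {A B q : ℂ} (hq : q ≠ 0) (hq1 : ‖q‖ < 1) (hA : A ≠ 0) (hB : B ≠ 0)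
    (hAB : ∀ n : ℤ, A * q ^ n ≠ B) : DifferentiableOn ℂ (halfConn A B q) {0}ᶜ := by
  intro z hz
  have hz0 : z ≠ 0 := hz
  have h1 : DifferentiableAt ℂ (fun z => theta q (-(A * z))) z :=
    DifferentiableAt.comp (g := theta q) z
      (differentiableAt_theta hq hq1 (neg_ne_zero.2 (mul_ne_zero hA hz))) (by fun_prop)
  have h2 : DifferentiableAt ℂ (fun z => conf A (A * q / B) q (q ^ 2 / (B * z))) z :=
    DifferentiableAt.comp (g := conf A (A * q / B) q) z
      (differentiable_conf hq hq1 A (qPochInf_mul_div_ne_zero hq hq1 hB hAB) _)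
      (by have := mul_ne_zero hB hz0; fun_prop (disch := assumption))
  exact ((h1.const_mul _).mul h2).differentiableWithinAt

open Classical in
/-- The entire function `(z;q)_∞ ₂φ₁(A, B; 0; q, z)`: the series is used in the unit disc and the
connection formula outside of it. -/
noncomputable def phiEntire (A B q z : ℂ) : ℂ :=
  if ‖z‖ < 1 then qPochInf z q * phiZero A B q z
  else (halfConn A B q z + halfConn B A q z) / (qPochInf q q * qPochInf (q / z) q)

lemma phiEntire_of_norm_lt {A B q z : ℂ} (hz : ‖z‖ < 1) :
    phiEntire A B q z = qPochInf z q * phiZero A B q z := if_pos hz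

lemma phiEntire_of_lt_norm {A B q z : ℂ} (hq : q ≠ 0) (hq1 : ‖q‖ < 1) (hA : A ≠ 0) (hB : B ≠ 0)
    (hAB : ∀ n : ℤ, A * q ^ n ≠ B) (hz : ‖q‖ < ‖z‖) :
    phiEntire A B q z =
      (halfConn A B q z + halfConn B A q z) / (qPochInf q q * qPochInf (q / z) q) := by
  rw [phiEntire]
  split_ifs with h
  · have hz0 : z ≠ 0 := norm_pos_iff.1 ((norm_nonneg q).trans_lt hz)
    have h1 := qPochInf_self_ne_zero hq1
    have h2 := qPochInf_ne_zero_of_norm_lt hq1 (norm_div_lt_one_of_lt hz)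
    rw [← theta_mul_phiZero hq hq1 hA hB hAB hz h, theta_eq_prod hq hq1 (neg_ne_zero.2 hz0),
      neg_neg, show -(q / -z) = q / z by rw [div_neg, neg_neg]]
    field_simp
  · rfl

lemma differentiable_phiEntire {A B q : ℂ} (hq : q ≠ 0) (hq1 : ‖q‖ < 1) (hA : A ≠ 0) (hB : B ≠ 0)
    (hAB : ∀ n : ℤ, A * q ^ n ≠ B) : Differentiable ℂ (phiEntire A B q) := by
  intro z
  have hE := differentiable_qPochInf hq hq1
  rcases lt_or_ge ‖z‖ 1 with hz | hz
  · have hz' : Metric.ball (0 : ℂ) 1 ∈ 𝓝 z := Metric.isOpen_ball.mem_nhds (by simpa using hz)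
    refine ((hE z).mul
      ((differentiableOn_phiZero hq1 A B).differentiableAt hz')).congr_of_eventuallyEq ?_
    filter_upwards [hz'] with w hw
    exact phiEntire_of_norm_lt (by simpa using hw)
  · have hqz : ‖q‖ < ‖z‖ := hq1.trans_le hz
    have hz0 : z ≠ 0 := norm_pos_iff.1 ((norm_nonneg q).trans_lt hqz)
    have hz' : ({0}ᶜ : Set ℂ) ∈ 𝓝 z := isOpen_compl_singleton.mem_nhds hz0
    have h1 : DifferentiableAt ℂ (fun z => qPochInf q q * qPochInf (q / z) q) z :=
      ((hE (q / z)).comp z (by fun_prop (disch := assumption))).const_mul _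
    refine ((((differentiableOn_halfConn hq hq1 hA hB hAB).differentiableAt hz').add
      ((differentiableOn_halfConn hq hq1 hB hA (mul_zpow_ne_symm hq hAB)).differentiableAt hz')).div
      h1 (mul_ne_zero (qPochInf_self_ne_zero hq1)
        (qPochInf_ne_zero_of_norm_lt hq1 (norm_div_lt_one_of_lt hqz)))).congr_of_eventuallyEq ?_
    filter_upwards [continuous_norm.continuousAt.eventually_const_lt hqz] with w hw
    exact phiEntire_of_lt_norm hq hq1 hA hB hAB hw

/-- The connection formula on all of `ℂ*`. -/
lemma mul_phiEntire {A B q z : ℂ} (hq : q ≠ 0) (hq1 : ‖q‖ < 1) (hA : A ≠ 0) (hB : B ≠ 0)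
    (hAB : ∀ n : ℤ, A * q ^ n ≠ B) (hz : z ≠ 0) :
    qPochInf q q * qPochInf (q / z) q * phiEntire A B q z =
      halfConn A B q z + halfConn B A q z := by
  have hd1 : DifferentiableOn ℂ
      (fun z => qPochInf q q * qPochInf (q / z) q * phiEntire A B q z) {0}ᶜ := by
    intro w hw
    have hw0 : w ≠ 0 := hw
    have h1 : DifferentiableAt ℂ (fun z => qPochInf q q * qPochInf (q / z) q) w :=
      ((differentiable_qPochInf hq hq1 (q / w)).comp w
        (by fun_prop (disch := assumption))).const_mul _
    exact (h1.mul (differentiable_phiEntire hq hq1 hA hB hAB w)).differentiableWithinAt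
  refine eqOn_of_eventuallyEq hd1 ((differentiableOn_halfConn hq hq1 hA hB hAB).add
    (differentiableOn_halfConn hq hq1 hB hA (mul_zpow_ne_symm hq hAB))) (x := 1) one_ne_zero ?_ hz
  filter_upwards [continuous_norm.continuousAt.eventually_const_lt
    (show ‖q‖ < ‖(1 : ℂ)‖ by simpa using hq1)] with w hw
  rw [phiEntire_of_lt_norm hq hq1 hA hB hAB hw, mul_div_cancel₀]
  · rfl
  · exact mul_ne_zero (qPochInf_self_ne_zero hq1)
      (qPochInf_ne_zero_of_norm_lt hq1 (norm_div_lt_one_of_lt hw))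

lemma coeff_basicHyp_two_one_zero (A B q : ℂ) (n : ℕ) :
    PowerSeries.coeff n (basicHyp [A, B] [0] q) = qPoch A q n * qPoch B q n / qPoch q q n := by
  simp [basicHyp, qPoch_zero_left]

lemma coeff_basicHyp_zero_one (a c q : ℂ) (n : ℕ) :
    PowerSeries.coeff n (basicHyp [a, 0] [c] q) = qPoch a q n / (qPoch c q n * qPoch q q n) := by
  simp [basicHyp, qPoch_zero_left]

/-- The Borel transformation cancels the divergent factor `q^(-n(n-1)/2)` of the coefficients of
`₂φ₀(a, b; -; q, x)`. -/
lemma coeff_qBorel_basicHyp {q : ℂ} (hq : q ≠ 0) (a b : ℂ) (n : ℕ) :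
    PowerSeries.coeff n (qBorel q (basicHyp [a, b] [] q)) =
      qPoch a q n * qPoch b q n / qPoch q q n * (-1) ^ n := by
  have h1 : q ^ (n * (n - 1) / 2) ≠ 0 := pow_ne_zero _ hq
  have h2 : ((-1 : ℂ) ^ n)⁻¹ = (-1) ^ n := by rw [← inv_pow]; norm_num
  simp only [qBorel, basicHyp, PowerSeries.coeff_mk, List.map_cons, List.map_nil, List.prod_cons,
    List.prod_nil, List.length_cons, List.length_nil, mul_one, one_mul]
  norm_num
  rw [h2]
  field_simp

lemma hasSum_basicHyp_phiEntire {A B q z : ℂ} (hq1 : ‖q‖ < 1) (hz : ‖z‖ < 1) :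
    HasSum (fun n : ℕ => PowerSeries.coeff n (basicHyp [A, B] [0] q) * z ^ n)
      (phiEntire A B q z / qPochInf z q) := by
  simp only [coeff_basicHyp_two_one_zero]
  rw [phiEntire_of_norm_lt hz, mul_div_cancel_left₀ _ (qPochInf_ne_zero_of_norm_lt hq1 hz)]
  exact hasSum_phiZero hq1 A B hz

lemma eventually_norm_lt_one : ∀ᶠ z : ℂ in 𝓝 0, ‖z‖ < 1 :=
  continuous_norm.continuousAt.eventually_lt_const (by simp)

lemma exists_isMeroCont_phi {A B q : ℂ} (hq : q ≠ 0) (hq1 : ‖q‖ < 1) (hA : A ≠ 0) (hB : B ≠ 0)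
    (hAB : ∀ n : ℤ, A * q ^ n ≠ B) : ∃ F, IsMeroCont (basicHyp [A, B] [0] q) F :=
  ⟨_, isMeroCont_div (differentiable_phiEntire hq hq1 hA hB hAB) (differentiable_qPochInf hq hq1)
    (by simp [qPochInf_zero]) (eventually_norm_lt_one.mono fun _ => hasSum_basicHyp_phiEntire hq1)⟩

lemma phi21_zero_eq {A B q z : ℂ} (hq : q ≠ 0) (hq1 : ‖q‖ < 1) (hA : A ≠ 0) (hB : B ≠ 0)
    (hAB : ∀ n : ℤ, A * q ^ n ≠ B) (hz : qPochInf z q ≠ 0) :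
    phi21 A B 0 q z = phiEntire A B q z / qPochInf z q :=
  meroCont_eq_div (differentiable_phiEntire hq hq1 hA hB hAB) (differentiable_qPochInf hq hq1)
    (by simp [qPochInf_zero])
    (eventually_norm_lt_one.mono fun _ => hasSum_basicHyp_phiEntire hq1) hz

/-- The Borel transform of `₂φ₀(a, b; -; q, x)` is `₂φ₁(a, b; 0; q, -ξ)`. -/
lemma hasSum_qBorel {a b q z : ℂ} (hq : q ≠ 0) (hq1 : ‖q‖ < 1) (hz : ‖z‖ < 1) :
    HasSum (fun n : ℕ => PowerSeries.coeff n (qBorel q (basicHyp [a, b] [] q)) * z ^ n)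
      (phiEntire a b q (-z) / qPochInf (-z) q) := by
  have h := hasSum_basicHyp_phiEntire (A := a) (B := b) hq1 (z := -z) (by rwa [norm_neg])
  simp only [coeff_basicHyp_two_one_zero] at h
  simp only [coeff_qBorel_basicHyp hq]
  refine Eq.mpr (congrArg (HasSum · _) (funext fun n => ?_)) h
  rw [neg_pow z, mul_assoc]

lemma differentiable_qBorel_num {a b q : ℂ} (hq : q ≠ 0) (hq1 : ‖q‖ < 1) (ha : a ≠ 0) (hb : b ≠ 0)
    (hab : ∀ n : ℤ, a * q ^ n ≠ b) : Differentiable ℂ fun z => phiEntire a b q (-z) :=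
  (differentiable_phiEntire hq hq1 ha hb hab).comp differentiable_neg

lemma differentiable_qBorel_den {q : ℂ} (hq : q ≠ 0) (hq1 : ‖q‖ < 1) :
    Differentiable ℂ fun z => qPochInf (-z) q :=
  (differentiable_qPochInf hq hq1).comp differentiable_neg

lemma exists_isMeroCont_qBorel {a b q : ℂ} (hq : q ≠ 0) (hq1 : ‖q‖ < 1) (ha : a ≠ 0) (hb : b ≠ 0)
    (hab : ∀ n : ℤ, a * q ^ n ≠ b) : ∃ F, IsMeroCont (qBorel q (basicHyp [a, b] [] q)) F :=
  ⟨_, isMeroCont_div (differentiable_qBorel_num hq hq1 ha hb hab) (differentiable_qBorel_den hq hq1)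
    (by simp [qPochInf_zero]) (eventually_norm_lt_one.mono fun _ => hasSum_qBorel hq hq1)⟩

lemma meroCont_qBorel_eq {a b q z : ℂ} (hq : q ≠ 0) (hq1 : ‖q‖ < 1) (ha : a ≠ 0) (hb : b ≠ 0)
    (hab : ∀ n : ℤ, a * q ^ n ≠ b) (hz : qPochInf (-z) q ≠ 0) :
    meroCont (qBorel q (basicHyp [a, b] [] q)) z = phiEntire a b q (-z) / qPochInf (-z) q :=
  meroCont_eq_div (differentiable_qBorel_num hq hq1 ha hb hab) (differentiable_qBorel_den hq hq1)
    (by simp [qPochInf_zero]) (eventually_norm_lt_one.mono fun _ => hasSum_qBorel hq hq1) hz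

/-! ### The continuation of `₂φ₁(a, 0; c; q, z)` -/

open PowerSeries in
/-- The coefficients of `(z;q)_∞ ₂φ₁(a, 0; c; q, z)`, read off from the `q`-difference equation that
this product satisfies as a formal power series. -/
lemma coeff_euler_mul_basicHyp {a c q : ℂ} (hq : q ≠ 0) (hq1 : ‖q‖ < 1) (ha : a ≠ 0)
    (hc : qPochInf c q ≠ 0) (n : ℕ) :
    coeff n (mk (fun n : ℕ => gauss q n * (-1) ^ n / qPoch q q n) * basicHyp [a, 0] [c] q) =
      confCoeff (c / a) c q n * a ^ n := by
  have hqq := qPoch_ne_zero hq1 (qPochInf_self_ne_zero hq1)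
  have hcc := qPoch_ne_zero hq1 hc
  have hq2 : ∀ n : ℕ, 1 - q * q ^ n ≠ 0 := fun n => by
    have := hqq (n + 1); rw [qPoch_succ] at this; exact right_ne_zero_of_mul this
  have hc2 : ∀ n : ℕ, 1 - c * q ^ n ≠ 0 := fun n => by
    have := hcc (n + 1); rw [qPoch_succ] at this; exact right_ne_zero_of_mul this
  set E : PowerSeries ℂ := mk fun n : ℕ => gauss q n * (-1) ^ n / qPoch q q n with hE
  set Y : PowerSeries ℂ := basicHyp [a, 0] [c] q with hY
  -- `e = c/q` and `d = 1 + c/q` are the coefficients of the `q`-difference equation of `Y`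
  obtain ⟨e, he⟩ : ∃ e, e * q = c := ⟨c / q, div_mul_cancel₀ c hq⟩
  obtain ⟨d, hd⟩ : ∃ d, d = 1 + e := ⟨_, rfl⟩
  have eE : E = (1 - X) * rescale q E := by
    ext n
    rcases n with _ | n
    · simp only [sub_mul, one_mul, map_sub, coeff_zero_X_mul, coeff_rescale, pow_zero, sub_zero]
    · rw [sub_mul, one_mul, map_sub, coeff_succ_X_mul, coeff_rescale, coeff_rescale, hE, coeff_mk,
        coeff_mk, qPoch_succ]
      have h1 := hqq n
      have h2 := hq2 n
      push_cast
      rw [gauss_succ hq, zpow_natCast, pow_succ (-1 : ℂ), pow_succ q]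
      generalize q ^ n = t at *
      have h3 : 1 - t * q ≠ 0 := by rwa [mul_comm]
      field_simp
      ring
  have eE2 : rescale q E = (1 - C q * X) * rescale q (rescale q E) := by
    conv_lhs => rw [eE]
    rw [map_mul, map_sub, map_one, rescale_X]
  have eY : (1 - X) * Y - (C d - C a * X) * rescale q Y + C e * rescale q (rescale q Y) = 0 := by
    ext n
    rcases n with _ | n
    · simp only [sub_mul, one_mul, map_sub, map_add, mul_assoc, coeff_zero_X_mul, coeff_rescale,
        coeff_C_mul, pow_zero, map_zero]
      linear_combination -coeff 0 Y * hd
    · simp only [sub_mul, one_mul, map_sub, map_add, mul_assoc, coeff_succ_X_mul, coeff_rescale,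
        coeff_C_mul, map_zero]
      have hu : coeff (n + 1) Y * ((1 - q * q ^ n) * (1 - c * q ^ n)) =
          coeff n Y * (1 - a * q ^ n) := by
        rw [hY, coeff_basicHyp_zero_one, coeff_basicHyp_zero_one, qPoch_succ, qPoch_succ,
          qPoch_succ]
        have h1 := hqq n
        have h2 := hq2 n
        have h3 := hcc n
        have h4 := hc2 n
        generalize q ^ n = t at *
        rw [mul_comm q t] at *
        rw [mul_comm c t] at *
        field_simp
      rw [hd, pow_succ q]
      linear_combination hu + coeff (n + 1) Y * (-q ^ n + q * (q ^ n) ^ 2) * he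
  -- the equation of the product: its recurrence has two terms since `1 - X` divides out
  have eH : (E * Y) - (C d - C a * X) * rescale q (E * Y) +
      C e * (1 - C q * X) * rescale q (rescale q (E * Y)) = 0 := by
    have hX : (1 - X : PowerSeries ℂ) ≠ 0 := by
      intro h
      have := congrArg (coeff 0) h
      simp at this
    refine mul_left_cancel₀ hX ?_
    have h := congrArg (E * ·) eY
    simp only [mul_zero] at h
    rw [mul_zero, map_mul, map_mul, ← h]
    linear_combination ((C d - C a * X) * rescale q Y -
      C e * rescale q (rescale q Y)) * eE - (1 - X) * C e * rescale q (rescale q Y) * eE2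
  induction n with
  | zero =>
    rw [coeff_mul, Finset.HasAntidiagonal.antidiagonal_zero, Finset.sum_singleton, hE, hY, coeff_mk,
      coeff_basicHyp_zero_one]
    simp [confCoeff, qPoch_zero, gauss_zero]
  | succ n ih =>
    have h := congrArg (coeff (n + 1)) eH
    simp only [sub_mul, mul_sub, mul_one, map_sub, map_add, mul_assoc, coeff_succ_X_mul,
      coeff_rescale, coeff_C_mul, map_zero, ih] at h
    have h1 := hqq n
    have h2 := hq2 n
    have h3 := hcc n
    have h4 := hc2 n
    have h5 : coeff (n + 1) (E * Y) * ((1 - q * q ^ n) * (1 - c * q ^ n)) =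
        -q ^ n * (a - c * q ^ n) * (confCoeff (c / a) c q n * a ^ n) := by
      rw [hd, pow_succ q] at h
      linear_combination h - (coeff (n + 1) (E * Y) * (-q ^ n + q * (q ^ n) ^ 2) -
        (q ^ n) ^ 2 * (confCoeff (c / a) c q n * a ^ n)) * he
    rw [← eq_div_iff (mul_ne_zero h2 h4)] at h5
    rw [h5, confCoeff, confCoeff, qPoch_succ, qPoch_succ, qPoch_succ]
    push_cast
    rw [gauss_succ hq, zpow_natCast, pow_succ (-1 : ℂ), pow_succ a]
    generalize q ^ n = t at *
    field_simp

lemma summable_basicHyp_conf {a c q z : ℂ} (hq1 : ‖q‖ < 1) (hc : qPochInf c q ≠ 0) (hz : ‖z‖ < 1) :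
    Summable fun n : ℕ => ‖PowerSeries.coeff n (basicHyp [a, 0] [c] q) * z ^ n‖ := by
  refine Summable.of_nonneg_of_le (fun _ => norm_nonneg _) (fun n => ?_)
    ((summable_geometric_of_lt_one (norm_nonneg z) hz).mul_left (Real.exp (‖a‖ / (1 - ‖q‖)) *
      (Real.exp (‖c‖ / (1 - ‖q‖)) / ‖qPochInf c q‖) *
      (Real.exp (‖q‖ / (1 - ‖q‖)) / ‖qPochInf q q‖)))
  rw [coeff_basicHyp_zero_one, div_eq_mul_inv, mul_inv, ← mul_assoc, norm_mul, norm_mul, norm_mul,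
    norm_pow]
  gcongr
  · exact norm_qPoch_le hq1 _ _
  · exact norm_inv_qPoch_le hq1 hc _
  · exact norm_inv_qPoch_le hq1 (qPochInf_self_ne_zero hq1) _

/-- `(z;q)_∞ ₂φ₁(a, 0; c; q, z) = ₁φ₁(c/a; c; q, az)`. -/
lemma hasSum_basicHyp_conf {a c q z : ℂ} (hq : q ≠ 0) (hq1 : ‖q‖ < 1) (ha : a ≠ 0)
    (hc : qPochInf c q ≠ 0) (hz : ‖z‖ < 1) :
    HasSum (fun n : ℕ => PowerSeries.coeff n (basicHyp [a, 0] [c] q) * z ^ n)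
      (conf (c / a) c q (a * z) / qPochInf z q) := by
  have hY := summable_basicHyp_conf (a := a) hq1 hc hz
  have hE := summable_euler hq hq1 (-z)
  have h := tsum_mul_tsum_eq_tsum_sum_antidiagonal_of_summable_norm hE hY
  rw [← qPochInf_eq_tsum hq hq1] at h
  have h2 : ∀ n : ℕ, ∑ kl ∈ Finset.HasAntidiagonal.antidiagonal n,
      gauss q kl.1 * (-z) ^ kl.1 / qPoch q q kl.1 *
      (PowerSeries.coeff kl.2 (basicHyp [a, 0] [c] q) * z ^ kl.2) =
      confCoeff (c / a) c q n * (a * z) ^ n := by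
    intro n
    rw [mul_pow, ← mul_assoc, ← coeff_euler_mul_basicHyp hq hq1 ha hc, PowerSeries.coeff_mul,
      Finset.sum_mul]
    refine Finset.sum_congr rfl fun kl hkl => ?_
    rw [PowerSeries.coeff_mk, ← Finset.HasAntidiagonal.mem_antidiagonal.1 hkl, pow_add, neg_pow]
    ring
  simp only [h2] at h
  have h3 := hY.of_norm.hasSum
  rwa [(eq_div_iff_mul_eq (qPochInf_ne_zero_of_norm_lt hq1 hz)).2
    ((mul_comm _ _).trans h)] at h3

lemma differentiable_conf_mul {a c q : ℂ} (hq : q ≠ 0) (hq1 : ‖q‖ < 1)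
    (hc : qPochInf c q ≠ 0) : Differentiable ℂ fun z => conf (c / a) c q (a * z) :=
  (differentiable_conf hq hq1 _ hc).comp (by fun_prop)

lemma exists_isMeroCont_conf {a c q : ℂ} (hq : q ≠ 0) (hq1 : ‖q‖ < 1) (ha : a ≠ 0)
    (hc : qPochInf c q ≠ 0) : ∃ F, IsMeroCont (basicHyp [a, 0] [c] q) F :=
  ⟨_, isMeroCont_div (differentiable_conf_mul hq hq1 hc) (differentiable_qPochInf hq hq1)
    (by simp [qPochInf_zero])
    (eventually_norm_lt_one.mono fun _ => hasSum_basicHyp_conf hq hq1 ha hc)⟩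

lemma phi21_conf_eq {a c q z : ℂ} (hq : q ≠ 0) (hq1 : ‖q‖ < 1) (ha : a ≠ 0)
    (hc : qPochInf c q ≠ 0) (hz : qPochInf z q ≠ 0) :
    phi21 a 0 c q z = conf (c / a) c q (a * z) / qPochInf z q :=
  meroCont_eq_div (differentiable_conf_mul hq hq1 hc) (differentiable_qPochInf hq hq1)
    (by simp [qPochInf_zero])
    (eventually_norm_lt_one.mono fun _ => hasSum_basicHyp_conf hq hq1 ha hc) hz

/-! ### The second row -/

lemma eventually_qPochInf_mul_ne_zero {q c x : ℂ} (hq : q ≠ 0) (hq1 : ‖q‖ < 1) (hc : c ≠ 0)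
    (hx : x ≠ 0) : ∀ᶠ y in 𝓝[≠] x, qPochInf (c * y) q ≠ 0 := by
  refine eventually_ne_zero_of_differentiableOn (f := fun y => qPochInf (c * y) q)
    -- at `q/c` the function has the value `(q;q)_∞`
    (x₁ := q / c) ?_ (div_ne_zero hq hc) ?_ hx
  · exact ((differentiable_qPochInf hq hq1).comp
      (differentiable_id.const_mul c)).differentiableOn
  · rw [mul_div_cancel₀ _ hc]
    exact qPochInf_self_ne_zero hq1

lemma differentiableAt_theta_mul {q c x : ℂ} (hq : q ≠ 0) (hq1 : ‖q‖ < 1) (hc : c ≠ 0)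
    (hx : x ≠ 0) : DifferentiableAt ℂ (fun y => theta q (c * y)) x :=
  DifferentiableAt.comp (g := theta q) x (differentiableAt_theta hq hq1 (mul_ne_zero hc hx))
    (by fun_prop)

lemma analyticAt_theta_mul {q c x : ℂ} (hq : q ≠ 0) (hq1 : ‖q‖ < 1) (hc : c ≠ 0)
    (hx : x ≠ 0) : AnalyticAt ℂ (fun y => theta q (c * y)) x := by
  have h : DifferentiableOn ℂ (fun y => theta q (c * y)) {0}ᶜ := fun y hy =>
    (differentiableAt_theta_mul hq hq1 hc hy).differentiableWithinAt
  exact h.analyticOnNhd isOpen_compl_singleton x hx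

lemma eventually_theta_mul_ne_zero {q c x : ℂ} (hq : q ≠ 0) (hq1 : ‖q‖ < 1) (hc : c ≠ 0)
    (hx : x ≠ 0) : ∀ᶠ y in 𝓝[≠] x, theta q (c * y) ≠ 0 := by
  refine eventually_ne_zero_of_differentiableOn (f := fun y => theta q (c * y))
    (x₁ := c⁻¹) (fun y hy => (differentiableAt_theta_mul hq hq1 hc hy).differentiableWithinAt)
    (inv_ne_zero hc) ?_ hx
  rw [mul_inv_cancel₀ hc]
  exact theta_one_ne_zero hq hq1

lemma div_mul_zpow_ne {a b q : ℂ} (hq : q ≠ 0) (ha : a ≠ 0) (hb : b ≠ 0)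
    (hab : ∀ n : ℤ, a * q ^ n ≠ b) (n : ℤ) : q / a * q ^ n ≠ q / b := by
  intro h
  refine mul_zpow_ne_symm hq hab n ?_
  field_simp at h
  linear_combination h

/-- The zeros of `(abx;q)_∞` cancel the poles of `₂φ₁`, so that `₂f₁` is an entire function of `x`
divided by `θ(-qx)`. -/
lemma f21_eq {a b q x : ℂ} (hq : q ≠ 0) (hq1 : ‖q‖ < 1) (ha : a ≠ 0) (hb : b ≠ 0)
    (hab : ∀ n : ℤ, a * q ^ n ≠ b) (hx : x ≠ 0) (hθ : theta q (-q * x) ≠ 0) :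
    f21 a b q x = phiEntire (q / a) (q / b) q (a * b * x) / theta q (-q * x) := by
  have hG := differentiable_phiEntire hq hq1 (div_ne_zero hq ha) (div_ne_zero hq hb)
    (div_mul_zpow_ne hq ha hb hab)
  have hG' : ∀ y, AnalyticAt ℂ (fun y => phiEntire (q / a) (q / b) q (a * b * y)) y := fun y =>
    (hG.comp (differentiable_id.const_mul (a * b))).analyticAt y
  have hcongr : ∀ y : ℂ, y ≠ 0 →
      (fun x => qPochInf (a * b * x) q / theta q (-q * x) *
        phi21 (q / a) (q / b) 0 q (a * b * x)) =ᶠ[𝓝[≠] y]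
      fun x => phiEntire (q / a) (q / b) q (a * b * x) / theta q (-q * x) := by
    intro y hy
    filter_upwards [eventually_qPochInf_mul_ne_zero hq hq1 (mul_ne_zero ha hb) hy] with w hw
    rw [phi21_zero_eq hq hq1 (div_ne_zero hq ha) (div_ne_zero hq hb)
      (div_mul_zpow_ne hq ha hb hab) hw]
    field_simp
  have hm : MeromorphicOn (fun x => qPochInf (a * b * x) q / theta q (-q * x) *
      phi21 (q / a) (q / b) 0 q (a * b * x)) {0}ᶜ := fun y hy =>
    (((hG' y).meromorphicAt.div
      (analyticAt_theta_mul hq hq1 (neg_ne_zero.2 hq) hy).meromorphicAt)).congr (hcongr y hy).symm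
  rw [f21, toMeromorphicNFOn_eq_toMeromorphicNFAt hm hx,
    (toMeromorphicNFAt_eventuallyEq_nhds_congr (hcongr x hx)).eq_of_nhds,
    toMeromorphicNFAt_eq_self.2 (AnalyticAt.meromorphicNFAt
      (f := fun x => phiEntire (q / a) (q / b) q (a * b * x) / theta q (-q * x))
      ((hG' x).div (analyticAt_theta_mul hq hq1 (neg_ne_zero.2 hq) hx) hθ))]

/-- For the parameters of `₂f₁`, the connection formula has the solutions at infinity as terms. -/
lemma halfConn_eq_phi21 {a b q x : ℂ} (hq : q ≠ 0) (hq1 : ‖q‖ < 1) (ha : a ≠ 0) (hb : b ≠ 0)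
    (hab : ∀ n : ℤ, a * q ^ n ≠ b) (hx : x ≠ 0) (hE : qPochInf (q / (a * b * x)) q ≠ 0) :
    halfConn (q / b) (q / a) q (a * b * x) =
      qPochInf (q / a) q / qPochInf (b / a) q * theta q (-a * q * x) *
        (qPochInf (q / (a * b * x)) q * phi21 a 0 (a * q / b) q (q / (a * b * x))) := by
  rw [phi21_conf_eq hq hq1 ha (qPochInf_mul_div_ne_zero hq hq1 hb hab) hE, mul_div_cancel₀ _ hE,
    halfConn, show q / a / (q / b) = b / a by field_simp, show q / b * q / (q / a) = a * q / b by
    field_simp, show q ^ 2 / (q / a * (a * b * x)) = a * (q / (a * b * x)) by field_simp,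
    show a * q / b / a = q / b by field_simp,
    show -(q / b * (a * b * x)) = -a * q * x by field_simp]

/-- The auxiliary parameter `m` cancels in each product of a coefficient and a solution. -/
lemma coeffTwo_mul_solInf {a b q m x : ℂ} (h1 : theta q (m * x) ≠ 0)
    (h2 : theta q (a * m * x) ≠ 0) :
    coeffTwo m a b q x * solInf m a b q x =
      qPochInf (q / a) q / (qPochInf (b / a) q * qPochInf q q) *
        (theta q (-a * q * x) / theta q (-q * x)) * phi21 a 0 (a * q / b) q (q / (a * b * x)) := by
  rw [coeffTwo, solInf]
  generalize theta q (m * x) = t1 at *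
  generalize theta q (a * m * x) = t2 at *
  generalize theta q (-a * q * x) = t3
  generalize theta q (-q * x) = t4
  field_simp

/-- The second row of the matrix identity. -/
lemma f21_connection {a b q m x : ℂ} (hq : q ≠ 0) (hq1 : ‖q‖ < 1) (ha : a ≠ 0) (hb : b ≠ 0)
    (hab : ∀ n : ℤ, a * q ^ n ≠ b) (hx : x ≠ 0) (hθ : theta q (-q * x) ≠ 0)
    (h1 : theta q (m * x) ≠ 0) (h2 : theta q (a * m * x) ≠ 0) (h3 : theta q (b * m * x) ≠ 0)
    (hE : qPochInf (q / (a * b * x)) q ≠ 0) :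
    f21 a b q x = coeffTwo m a b q x * solInf m a b q x +
      coeffTwo m b a q x * solInf m b a q x := by
  have hz : a * b * x ≠ 0 := mul_ne_zero (mul_ne_zero ha hb) hx
  have K := mul_phiEntire hq hq1 (div_ne_zero hq ha) (div_ne_zero hq hb)
    (div_mul_zpow_ne hq ha hb hab) hz
  have hE' : qPochInf (q / (b * a * x)) q ≠ 0 := by rwa [mul_comm b a]
  have kA := halfConn_eq_phi21 hq hq1 ha hb hab hx hE
  have kB := halfConn_eq_phi21 hq hq1 hb ha (mul_zpow_ne_symm hq hab) hx hE'
  rw [coeffTwo_mul_solInf h1 h2, coeffTwo_mul_solInf h1 h3, f21_eq hq hq1 ha hb hab hx hθ]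
  rw [mul_comm b a] at kB ⊢
  rw [kA, kB] at K
  have hEq := qPochInf_self_ne_zero hq1
  have K' : phiEntire (q / a) (q / b) q (a * b * x) =
      (qPochInf (q / b) q / qPochInf (a / b) q * theta q (-b * q * x) *
        phi21 b 0 (b * q / a) q (q / (a * b * x)) +
      qPochInf (q / a) q / qPochInf (b / a) q * theta q (-a * q * x) *
        phi21 a 0 (a * q / b) q (q / (a * b * x))) / qPochInf q q := by
    rw [eq_div_iff hEq]
    refine mul_left_cancel₀ hE ?_
    linear_combination K
  rw [K']
  simp only [div_eq_mul_inv, mul_inv]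
  ring

/-! ### The first row -/

/-- The values of the continued Borel transform on the spiral `[l;q]`. -/
noncomputable def borelValue (a b q l : ℂ) (n : ℤ) : ℂ :=
  meroCont (qBorel q (basicHyp [a, b] [] q)) (q ^ n * l)

lemma qPochInf_neg_zpow_mul_ne_zero {q l : ℂ} (hq : q ≠ 0) (hq1 : ‖q‖ < 1) (hl : l ≠ 0)
    (hθ : theta q l ≠ 0) (n : ℤ) : qPochInf (-(q ^ n * l)) q ≠ 0 := by
  have h := theta_zpow_mul hq hl n
  have h0 : q ^ n * l ≠ 0 := mul_ne_zero (zpow_ne_zero n hq) hl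
  have h1 : theta q (q ^ n * l) ≠ 0 := by
    rw [h]
    exact div_ne_zero hθ (mul_ne_zero (gauss_ne_zero hq n) (zpow_ne_zero n hl))
  rw [theta_eq_prod hq hq1 h0] at h1
  exact right_ne_zero_of_mul (left_ne_zero_of_mul h1)

/-- One of the two terms of the connection formula for the Borel transform at `qⁿl`. -/
noncomputable def borelHalf (a b q l : ℂ) (n : ℤ) : ℂ :=
  a ^ (-n) * conf a (a * q / b) q (-(q ^ 2 / (b * (q ^ n * l))))

/-- The constant that multiplies `borelHalf`. -/
noncomputable def borelConst (a b q l : ℂ) : ℂ :=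
  qPochInf b q / qPochInf (b / a) q * (theta q (a * l) / theta q l)

lemma halfConn_div_theta {a b q l : ℂ} (hq : q ≠ 0) (ha : a ≠ 0) (hl : l ≠ 0)
    (hθ : theta q l ≠ 0) (n : ℤ) :
    halfConn a b q (-(q ^ n * l)) / theta q (q ^ n * l) =
      borelConst a b q l * borelHalf a b q l n := by
  rw [halfConn, borelConst, borelHalf, show -(a * -(q ^ n * l)) = q ^ n * (a * l) by ring,
    theta_zpow_mul hq hl, theta_zpow_mul hq (mul_ne_zero ha hl),
    show q ^ 2 / (b * -(q ^ n * l)) = -(q ^ 2 / (b * (q ^ n * l))) by rw [mul_neg, div_neg],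
    mul_zpow, zpow_neg]
  have h1 := gauss_ne_zero hq n
  have h2 := zpow_ne_zero n hl
  have h3 := zpow_ne_zero n ha
  field_simp

/-- The connection formula for the Borel transform, on the spiral `[l;q]`. -/
lemma borelValue_eq {a b q l : ℂ} (hq : q ≠ 0) (hq1 : ‖q‖ < 1) (ha : a ≠ 0) (hb : b ≠ 0)
    (hab : ∀ n : ℤ, a * q ^ n ≠ b) (hl : l ≠ 0) (hθ : theta q l ≠ 0) (n : ℤ) :
    borelValue a b q l n = borelConst a b q l * borelHalf a b q l n +
      borelConst b a q l * borelHalf b a q l n := by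
  have h0 : q ^ n * l ≠ 0 := mul_ne_zero (zpow_ne_zero n hq) hl
  have hE := qPochInf_neg_zpow_mul_ne_zero hq hq1 hl hθ n
  have K := mul_phiEntire hq hq1 ha hb hab (neg_ne_zero.2 h0)
  have hθn : theta q (q ^ n * l) ≠ 0 := by
    rw [theta_zpow_mul hq hl]
    exact div_ne_zero hθ (mul_ne_zero (gauss_ne_zero hq n) (zpow_ne_zero n hl))
  rw [← halfConn_div_theta hq ha hl hθ, ← halfConn_div_theta hq hb hl hθ, ← add_div, ← K,
    borelValue, meroCont_qBorel_eq hq hq1 ha hb hab hE, div_eq_div_iff hE hθn,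
    theta_eq_prod hq hq1 h0, div_neg]
  ring

/-- Towards infinity along the spiral the argument of `₁φ₁` tends to `0`, and only the character
`a⁻ⁿ` remains. -/
lemma exists_bound_borelHalf {a b q l : ℂ} (hq : q ≠ 0) (hq1 : ‖q‖ < 1) (ha : a ≠ 0) (hb : b ≠ 0)
    (hab : ∀ n : ℤ, a * q ^ n ≠ b) :
    ∃ C, 0 ≤ C ∧ ∀ k : ℕ, ‖borelHalf a b q l (-(k : ℤ))‖ ≤ C * ‖a‖ ^ k := by
  have hc := qPochInf_mul_div_ne_zero hq hq1 hb hab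
  have ht : Tendsto (fun k : ℕ => conf a (a * q / b) q (-(q ^ 2 / (b * l)) * q ^ k)) atTop
      (𝓝 (conf a (a * q / b) q (-(q ^ 2 / (b * l)) * 0))) :=
    ((differentiable_conf hq hq1 a hc).continuous.tendsto _).comp
      ((tendsto_pow_atTop_nhds_zero_of_norm_lt_one hq1).const_mul _)
  obtain ⟨C, hC, h⟩ := exists_forall_norm_le_of_tendsto ht
  refine ⟨C, hC, fun k => ?_⟩
  have e : -(q ^ 2 / (b * (q ^ (-(k : ℤ)) * l))) = -(q ^ 2 / (b * l)) * q ^ k := by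
    rw [zpow_neg, zpow_natCast]
    have : q ^ k ≠ 0 := pow_ne_zero _ hq
    rw [neg_mul, div_mul_eq_mul_div]
    congr 1
    rw [show b * ((q ^ k)⁻¹ * l) = b * l / q ^ k by field_simp, div_div_eq_mul_div]
  rw [borelHalf, e, neg_neg, zpow_natCast, norm_mul, norm_pow, mul_comm]
  gcongr
  exact h k

/-- The Borel transform grows at most geometrically along the spiral, so that the Laplace sum is a
Laurent series in `1/x` that converges on `ℂ*`. -/
lemma summable_borelValue {a b q l : ℂ} (hq : q ≠ 0) (hq1 : ‖q‖ < 1) (ha : a ≠ 0) (hb : b ≠ 0)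
    (hab : ∀ n : ℤ, a * q ^ n ≠ b) (hl : l ≠ 0) (hθ : theta q l ≠ 0) {w : ℂ} (hw : w ≠ 0) :
    Summable fun n : ℤ => ‖borelValue a b q l n * (gauss q n * w ^ n)‖ := by
  refine Summable.of_nat_of_neg ?_ ?_
  · have ht : Tendsto (fun n : ℕ => borelValue a b q l n) atTop
        (𝓝 (phiEntire a b q (-0) / qPochInf (-0) q)) := by
      have hc : ContinuousAt (fun z => phiEntire a b q (-z) / qPochInf (-z) q) 0 :=
        ((differentiable_qBorel_num hq hq1 ha hb hab 0).continuousAt).div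
          ((differentiable_qBorel_den hq hq1 0).continuousAt) (by simp [qPochInf_zero])
      have hs : Tendsto (fun n : ℕ => q ^ n * l) atTop (𝓝 0) := by
        simpa using (tendsto_pow_atTop_nhds_zero_of_norm_lt_one hq1).mul_const l
      refine (hc.tendsto.comp hs).congr fun n => ?_
      have h := meroCont_qBorel_eq hq hq1 ha hb hab
        (qPochInf_neg_zpow_mul_ne_zero hq hq1 hl hθ n)
      rw [borelValue, h, Function.comp_apply, zpow_natCast]
    obtain ⟨C, hC, h⟩ := exists_forall_norm_le_of_tendsto ht
    refine Summable.of_nonneg_of_le (fun _ => norm_nonneg _) (fun n => ?_)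
      ((summable_gauss_nat hq hq1 w).mul_left C)
    rw [norm_mul, zpow_natCast]
    gcongr
    exact h n
  · obtain ⟨C, hC, h1⟩ := exists_bound_borelHalf (l := l) hq hq1 ha hb hab
    obtain ⟨D, hD, h2⟩ := exists_bound_borelHalf (l := l) hq hq1 hb ha (mul_zpow_ne_symm hq hab)
    have hinj : Function.Injective fun k : ℕ => -(k : ℤ) :=
      neg_injective.comp Nat.cast_injective
    have s1 := ((summable_gauss_int hq hq1 (div_ne_zero hw ha)).comp_injective hinj).mul_left
      (‖borelConst a b q l‖ * C)
    have s2 := ((summable_gauss_int hq hq1 (div_ne_zero hw hb)).comp_injective hinj).mul_left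
      (‖borelConst b a q l‖ * D)
    refine Summable.of_nonneg_of_le (fun _ => norm_nonneg _) (fun k => ?_) (s1.add s2)
    have e : ∀ c : ℂ, ‖gauss q (-(k : ℤ)) * (w / c) ^ (-(k : ℤ))‖ =
        ‖c‖ ^ k * ‖gauss q (-(k : ℤ)) * w ^ (-(k : ℤ))‖ := by
      intro c
      rw [div_zpow, zpow_neg c, zpow_natCast, norm_mul, norm_mul, norm_div, norm_inv, norm_pow,
        div_inv_eq_mul]
      ring
    simp only [Function.comp_apply, e]
    rw [norm_mul, borelValue_eq hq hq1 ha hb hab hl hθ, ← mul_assoc, ← mul_assoc, ← add_mul]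
    refine mul_le_mul_of_nonneg_right ((norm_add_le _ _).trans ?_) (norm_nonneg _)
    rw [norm_mul, norm_mul, mul_assoc, mul_assoc]
    gcongr
    · exact h1 k
    · exact h2 k

/-- The Laplace sum multiplied by `θ(l/x)`, as a Laurent series in `w = 1/x`. -/
noncomputable def laplaceSeries (a b q l w : ℂ) : ℂ :=
  ∑' n : ℤ, borelValue a b q l n * gauss q n * l ^ n * w ^ n

lemma differentiableOn_laplaceSeries {a b q l : ℂ} (hq : q ≠ 0) (hq1 : ‖q‖ < 1) (ha : a ≠ 0)
    (hb : b ≠ 0) (hab : ∀ n : ℤ, a * q ^ n ≠ b) (hl : l ≠ 0) (hθ : theta q l ≠ 0) :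
    DifferentiableOn ℂ (laplaceSeries a b q l) {0}ᶜ := by
  refine differentiableOn_tsum_zpow (c := fun n => borelValue a b q l n * gauss q n * l ^ n)
    fun r hr => ?_
  have hr0 : l * (r : ℂ) ≠ 0 := mul_ne_zero hl (by exact_mod_cast hr.ne')
  refine (summable_borelValue hq hq1 ha hb hab hl hθ hr0).congr fun n => ?_
  rw [mul_zpow, norm_mul, norm_mul, norm_mul, norm_mul, norm_mul, norm_zpow (r : ℂ),
    Complex.norm_real, Real.norm_of_nonneg hr.le]
  ring

lemma laplace_term_eq {q l x : ℂ} (hq : q ≠ 0) (hl : l ≠ 0) (hx : x ≠ 0) (v : ℂ) (n : ℤ) :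
    v / theta q (q ^ n * l / x) = v * gauss q n * l ^ n * x⁻¹ ^ n / theta q (l / x) := by
  rw [mul_div_assoc, theta_zpow_mul hq (div_ne_zero hl hx), div_div_eq_mul_div, div_eq_mul_inv l,
    mul_zpow]
  ring

lemma summable_laplace {a b q l x : ℂ} (hq : q ≠ 0) (hq1 : ‖q‖ < 1) (ha : a ≠ 0)
    (hb : b ≠ 0) (hab : ∀ n : ℤ, a * q ^ n ≠ b) (hl : l ≠ 0) (hθ : theta q l ≠ 0) (hx : x ≠ 0) :
    Summable fun n : ℤ => meroCont (qBorel q (basicHyp [a, b] [] q)) (q ^ n * l) /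
      theta q (q ^ n * l / x) := by
  simp only [laplace_term_eq hq hl hx]
  refine Summable.div_const ?_ _
  refine (summable_borelValue hq hq1 ha hb hab hl hθ
    (mul_ne_zero hl (inv_ne_zero hx))).of_norm.congr fun n => ?_
  rw [borelValue, mul_zpow]
  ring

lemma f20_eq {a b q l x : ℂ} (hq : q ≠ 0) (hl : l ≠ 0) (hx : x ≠ 0) :
    f20 a b l q x = laplaceSeries a b q l x⁻¹ / theta q (l / x) := by
  rw [f20, qLaplace]
  simp only [laplace_term_eq hq hl hx]
  rw [tsum_div_const]
  rfl

/-- The Laplace transform of one half of the connection formula: the double series is absolutely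
convergent when `|qw/(ab)| < 1`, and factors after reindexing along the diagonal. -/
lemma hasSum_borelHalf {a b q l w : ℂ} (hq : q ≠ 0) (hq1 : ‖q‖ < 1) (ha : a ≠ 0)
    (hb : b ≠ 0) (hab : ∀ n : ℤ, a * q ^ n ≠ b) (hl : l ≠ 0) (hw : w ≠ 0)
    (hwab : ‖q * w / (a * b)‖ < 1) :
    HasSum (fun n : ℤ => borelHalf a b q l n * gauss q n * l ^ n * w ^ n)
      (conf (q / b) (a * q / b) q (q * w / b) / qPochInf (q * w / (a * b)) q *
        theta q (l / a * w)) := by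
  have hc := qPochInf_mul_div_ne_zero hq hq1 hb hab
  have hlw : l / a * w ≠ 0 := mul_ne_zero (div_ne_zero hl ha) hw
  have h := hasSum_shear (fun k : ℕ => -(k : ℤ)) (summable_basicHyp_conf (a := a) hq1 hc hwab)
    (summable_gauss_int hq hq1 hlw)
  rw [(hasSum_basicHyp_conf hq hq1 ha hc hwab).tsum_eq, ← theta_eq,
    show a * q / b / a = q / b by field_simp, show a * (q * w / (a * b)) = q * w / b by field_simp]
    at h
  refine Eq.mpr (congrArg (HasSum · _) (funext fun n => ?_)) h
  rw [borelHalf, conf, mul_assoc, mul_assoc, mul_right_comm, ← tsum_mul_left]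
  refine tsum_congr fun k => ?_
  have e1 : gauss q (n + -(k : ℤ)) = gauss q n * (gauss q k * q ^ k) * ((q ^ n) ^ k)⁻¹ := by
    rw [gauss_add hq, gauss_neg hq, zpow_natCast, mul_neg, zpow_neg, zpow_mul, zpow_natCast]
  have e2 : (l / a * w) ^ (n + -(k : ℤ)) =
      l ^ n * w ^ n * a ^ (-n) * (a ^ k * ((l * w) ^ k)⁻¹) := by
    rw [zpow_add₀ hlw, zpow_neg, zpow_natCast, zpow_neg, mul_zpow, div_zpow, mul_pow, div_pow,
      mul_pow]
    simp only [div_eq_mul_inv, mul_inv, inv_inv]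
    ring
  have e3 : (-(q ^ 2 / (b * (q ^ n * l)))) ^ k =
      (-1) ^ k * (q ^ k * q ^ k * (b ^ k)⁻¹ * ((q ^ n) ^ k)⁻¹ * (l ^ k)⁻¹) := by
    rw [neg_pow, div_pow, mul_pow, mul_pow, sq, mul_pow]
    simp only [div_eq_mul_inv, mul_inv]
    ring
  have e4 : (q * w / (a * b)) ^ k = q ^ k * w ^ k * (a ^ k)⁻¹ * (b ^ k)⁻¹ := by
    rw [div_pow, mul_pow, mul_pow, div_eq_mul_inv, mul_inv]
    ring
  have e5 : ((-1 : ℂ) ^ k) * (-1) ^ k = 1 := by rw [← mul_pow]; norm_num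
  have hak : a ^ k * (a ^ k)⁻¹ = 1 := mul_inv_cancel₀ (pow_ne_zero k ha)
  have hwk : w ^ k * (w ^ k)⁻¹ = 1 := mul_inv_cancel₀ (pow_ne_zero k hw)
  rw [e1, e2, e3, e4, confCoeff, coeff_basicHyp_zero_one, mul_pow l, mul_inv (l ^ k)]
  generalize qPoch a q k / (qPoch (a * q / b) q k * qPoch q q k) = u
  generalize (a ^ k)⁻¹ = a1 at *
  generalize (w ^ k)⁻¹ = w1 at *
  generalize (-1 : ℂ) ^ k = ε at *
  generalize a ^ k = a2 at *
  generalize w ^ k = w2 at *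
  generalize (b ^ k)⁻¹ = b1
  generalize ((q ^ n) ^ k)⁻¹ = q1
  generalize (l ^ k)⁻¹ = l1
  linear_combination (a ^ (-n) * l ^ n * w ^ n * u * gauss q k * gauss q n * q ^ k * q ^ k *
    b1 * q1 * l1) * (e5 - hak * (w2 * w1) - hwk)

/-- The Laplace sum evaluated: by `hasSum_borelHalf` for `w` near `ab`, where `|qw/(ab)|` is close
to `|q|`, and on `ℂ*` by the identity theorem. -/
lemma laplaceSeries_eq {a b q l w : ℂ} (hq : q ≠ 0) (hq1 : ‖q‖ < 1) (ha : a ≠ 0)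
    (hb : b ≠ 0) (hab : ∀ n : ℤ, a * q ^ n ≠ b) (hl : l ≠ 0) (hθ : theta q l ≠ 0) (hw : w ≠ 0) :
    qPochInf (q * w / (a * b)) q * laplaceSeries a b q l w =
      borelConst a b q l * (conf (q / b) (a * q / b) q (q * w / b) * theta q (l / a * w)) +
      borelConst b a q l * (conf (q / a) (b * q / a) q (q * w / a) * theta q (l / b * w)) := by
  have hba := mul_zpow_ne_symm hq hab
  have hE : Differentiable ℂ fun w => qPochInf (q * w / (a * b)) q :=
    (differentiable_qPochInf hq hq1).comp (by fun_prop)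
  have hd : ∀ a b : ℂ, a ≠ 0 → b ≠ 0 → (∀ n : ℤ, a * q ^ n ≠ b) → DifferentiableOn ℂ
      (fun w => borelConst a b q l *
        (conf (q / b) (a * q / b) q (q * w / b) * theta q (l / a * w))) {0}ᶜ := by
    intro a b ha hb hab w hw
    have h1 : Differentiable ℂ fun w => conf (q / b) (a * q / b) q (q * w / b) :=
      (differentiable_conf hq hq1 _ (qPochInf_mul_div_ne_zero hq hq1 hb hab)).comp (by fun_prop)
    exact (((h1 w).mul (differentiableAt_theta_mul hq hq1
      (div_ne_zero hl ha) hw)).const_mul _).differentiableWithinAt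
  refine eqOn_of_eventuallyEq (f := fun w => qPochInf (q * w / (a * b)) q * laplaceSeries a b q l w)
    (g := fun w =>
      borelConst a b q l * (conf (q / b) (a * q / b) q (q * w / b) * theta q (l / a * w)) +
      borelConst b a q l * (conf (q / a) (b * q / a) q (q * w / a) * theta q (l / b * w)))
    (hE.differentiableOn.mul (differentiableOn_laplaceSeries hq hq1 ha hb hab hl hθ))
    ((hd a b ha hb hab).add (hd b a hb ha hba)) (x := a * b) (mul_ne_zero ha hb) ?_ hw
  have hc : ContinuousAt (fun w : ℂ => ‖q * w / (a * b)‖) (a * b) := by fun_prop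
  have h1 : ∀ᶠ w in 𝓝 (a * b), ‖q * w / (a * b)‖ < 1 :=
    hc.eventually_lt_const (show ‖q * (a * b) / (a * b)‖ < 1 by
      rwa [mul_div_cancel_right₀ _ (mul_ne_zero ha hb)])
  filter_upwards [h1, isOpen_ne.mem_nhds (mul_ne_zero ha hb)] with w hw1 hw0
  have hw2 : ‖q * w / (b * a)‖ < 1 := by rwa [mul_comm b a]
  have s := ((hasSum_borelHalf hq hq1 ha hb hab hl hw0 hw1).mul_left (borelConst a b q l)).add
    ((hasSum_borelHalf hq hq1 hb ha hba hl hw0 hw2).mul_left (borelConst b a q l))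
  have e : laplaceSeries a b q l w =
      ∑' n : ℤ, (borelConst a b q l * (borelHalf a b q l n * gauss q n * l ^ n * w ^ n) +
        borelConst b a q l * (borelHalf b a q l n * gauss q n * l ^ n * w ^ n)) := by
    refine tsum_congr fun n => ?_
    rw [borelValue_eq hq hq1 ha hb hab hl hθ]
    ring
  have hne := qPochInf_ne_zero_of_norm_lt hq1 hw1
  rw [e, s.tsum_eq, mul_comm b a]
  generalize qPochInf (q * w / (a * b)) q = t at *
  simp only [div_mul_eq_mul_div, mul_div_assoc', ← add_div]
  rw [mul_div_cancel_left₀ _ hne]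

/-- The products of coefficients and solutions in the first row, in the form in which they come out
of the Laplace sum. The symmetry `θ(q/y) = θ(y)` relates the theta quotients. -/
lemma coeffOne_mul_solInf {a b q l m x : ℂ} (hq : q ≠ 0) (hq1 : ‖q‖ < 1) (ha : a ≠ 0) (hb : b ≠ 0)
    (hab : ∀ n : ℤ, a * q ^ n ≠ b) (hl : l ≠ 0) (hx : x ≠ 0) (h1 : theta q (m * x) ≠ 0)
    (h2 : theta q (a * m * x) ≠ 0) (hE : qPochInf (q / (a * b * x)) q ≠ 0) :
    coeffOne l m a b q x * solInf m a b q x =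
      borelConst a b q l * (conf (q / b) (a * q / b) q (q * x⁻¹ / b) * theta q (l / a * x⁻¹)) /
        (qPochInf (q / (a * b * x)) q * theta q (l / x)) := by
  have e1 := theta_q_div hq hq1 (div_ne_zero hl hx)
  have e2 := theta_q_div hq hq1 (mul_ne_zero (div_ne_zero hl ha) (inv_ne_zero hx))
  rw [coeffOne, solInf, borelConst,
    phi21_conf_eq hq hq1 ha (qPochInf_mul_div_ne_zero hq hq1 hb hab) hE,
    show a * q / b / a = q / b by field_simp,
    show a * (q / (a * b * x)) = q * x⁻¹ / b by field_simp,
    ← e1, ← e2, show q / (l / x) = q * x / l by field_simp,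
    show q / (l / a * x⁻¹) = q * a * x / l by field_simp]
  generalize theta q (m * x) = t1 at *
  generalize theta q (a * m * x) = t2 at *
  generalize theta q (q * a * x / l) = t3
  generalize theta q (q * x / l) = t4
  generalize qPochInf (q / (a * b * x)) q = t5 at *
  field_simp

/-- The first row of the matrix identity. -/
lemma f20_connection {a b q l m x : ℂ} (hq : q ≠ 0) (hq1 : ‖q‖ < 1) (ha : a ≠ 0) (hb : b ≠ 0)
    (hab : ∀ n : ℤ, a * q ^ n ≠ b) (hl : l ≠ 0) (hθ : theta q l ≠ 0) (hx : x ≠ 0)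
    (h1 : theta q (m * x) ≠ 0) (h2 : theta q (a * m * x) ≠ 0) (h3 : theta q (b * m * x) ≠ 0)
    (hE : qPochInf (q / (a * b * x)) q ≠ 0) :
    f20 a b l q x = coeffOne l m a b q x * solInf m a b q x +
      coeffOne l m b a q x * solInf m b a q x := by
  have hE' : qPochInf (q / (b * a * x)) q ≠ 0 := by rwa [mul_comm b a]
  have K := laplaceSeries_eq hq hq1 ha hb hab hl hθ (inv_ne_zero hx)
  rw [show q * x⁻¹ / (a * b) = q / (a * b * x) by field_simp] at K
  rw [coeffOne_mul_solInf hq hq1 ha hb hab hl hx h1 h2 hE,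
    coeffOne_mul_solInf hq hq1 hb ha (mul_zpow_ne_symm hq hab) hl hx h1 h3 hE', mul_comm b a,
    ← add_div, ← K, f20_eq hq hl hx, mul_div_mul_left _ _ hE]

/-! ### Ellipticity -/

/-- A product of theta quotients whose multipliers cancel: `x ↦ qx` divides the first quotient by
`a` and multiplies the second by `a`. -/
lemma isQElliptic_theta_quotient {q a c m : ℂ} (hq : q ≠ 0) (hq1 : ‖q‖ < 1) (ha : a ≠ 0)
    (hc : c ≠ 0) (hm : m ≠ 0) (κ : ℂ) :
    IsQElliptic q fun x => κ * (theta q (a * c * x) / theta q (c * x)) *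
      (theta q (m * x) / theta q (a * m * x)) := by
  constructor
  · intro x hx
    have h : ∀ d : ℂ, d ≠ 0 → MeromorphicAt (fun x => theta q (d * x)) x := fun d hd =>
      (analyticAt_theta_mul hq hq1 hd hx).meromorphicAt
    exact ((MeromorphicAt.const κ x).mul ((h _ (mul_ne_zero ha hc)).div (h _ hc))).mul
      ((h _ hm).div (h _ (mul_ne_zero ha hm)))
  · intro x hx
    have h : ∀ d : ℂ, d ≠ 0 → theta q (d * (q * x)) = theta q (d * x) / (d * x) := by
      intro d hd
      rw [← theta_q_mul hq (mul_ne_zero hd hx)]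
      congr 1
      ring
    beta_reduce
    rw [h _ (mul_ne_zero ha hc), h _ hc, h _ hm, h _ (mul_ne_zero ha hm), div_div_div_eq,
      div_div_div_eq]
    generalize theta q (a * c * x) = t1
    generalize theta q (c * x) = t2
    generalize theta q (m * x) = t3
    generalize theta q (a * m * x) = t4
    simp only [div_eq_mul_inv, mul_inv]
    field_simp

lemma isQElliptic_coeffOne {q a b l m : ℂ} (hq : q ≠ 0) (hq1 : ‖q‖ < 1) (ha : a ≠ 0) (hl : l ≠ 0)
    (hm : m ≠ 0) : IsQElliptic q (coeffOne l m a b q) := by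
  have h := isQElliptic_theta_quotient hq hq1 ha (div_ne_zero hq hl) hm
    (qPochInf b q / qPochInf (b / a) q * (theta q (a * l) / theta q l))
  convert h using 2 with x
  rw [coeffOne, show q * a * x / l = a * (q / l) * x by ring, show q * x / l = q / l * x by ring]

lemma isQElliptic_coeffTwo {q a b m : ℂ} (hq : q ≠ 0) (hq1 : ‖q‖ < 1) (ha : a ≠ 0)
    (hm : m ≠ 0) : IsQElliptic q (coeffTwo m a b q) := by
  have h := isQElliptic_theta_quotient hq hq1 ha (neg_ne_zero.2 hq) hm
    (qPochInf (q / a) q / (qPochInf (b / a) q * qPochInf q q))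
  convert h using 2 with x
  rw [coeffTwo, show -a * q * x = a * -q * x by ring]

/-! ### Continuity of the left side, and exceptional sets -/

lemma continuousAt_f20 {a b q l x : ℂ} (hq : q ≠ 0) (hq1 : ‖q‖ < 1) (ha : a ≠ 0) (hb : b ≠ 0)
    (hab : ∀ n : ℤ, a * q ^ n ≠ b) (hl : l ≠ 0) (hθ : theta q l ≠ 0) (hx : x ≠ 0)
    (hlx : theta q (l / x) ≠ 0) : ContinuousAt (f20 a b l q) x := by
  have h1 : ContinuousAt (fun y : ℂ => laplaceSeries a b q l y⁻¹) x :=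
    ContinuousAt.comp (g := laplaceSeries a b q l)
      ((differentiableOn_laplaceSeries hq hq1 ha hb hab hl hθ).differentiableAt
        (isOpen_compl_singleton.mem_nhds (inv_ne_zero hx))).continuousAt (continuousAt_inv₀ hx)
  have h2 : ContinuousAt (fun y : ℂ => theta q (l / y)) x :=
    ContinuousAt.comp (g := theta q)
      (differentiableAt_theta hq hq1 (div_ne_zero hl hx)).continuousAt
      (continuousAt_const.div continuousAt_id hx)
  refine (h1.div h2 hlx).congr ?_
  filter_upwards [continuousAt_id.eventually_ne hx] with y hy
  exact (f20_eq hq hl hy).symm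

lemma continuousAt_f21 {a b q x : ℂ} (hq : q ≠ 0) (hq1 : ‖q‖ < 1) (ha : a ≠ 0) (hb : b ≠ 0)
    (hab : ∀ n : ℤ, a * q ^ n ≠ b) (hx : x ≠ 0) (hθ : theta q (-q * x) ≠ 0) :
    ContinuousAt (f21 a b q) x := by
  have h1 : ContinuousAt (fun y => phiEntire (q / a) (q / b) q (a * b * y)) x :=
    ((differentiable_phiEntire hq hq1 (div_ne_zero hq ha) (div_ne_zero hq hb)
      (div_mul_zpow_ne hq ha hb hab)).continuous.comp (continuous_const_mul (a * b))).continuousAt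
  have h2 := (differentiableAt_theta_mul hq hq1 (neg_ne_zero.2 hq) hx).continuousAt
  refine (h1.div h2 hθ).congr ?_
  filter_upwards [continuousAt_id.eventually_ne hx, h2.eventually_ne hθ] with y hy hy2
  exact (f21_eq hq hq1 ha hb hab hy hy2).symm

lemma theta_mul_ne_zero_of_notMem_spiral {q c x : ℂ} (hq : q ≠ 0) (hq1 : ‖q‖ < 1) (hc : c ≠ 0)
    (hx : x ≠ 0) (h : x ∉ spiral (-1 / c) q) : theta q (c * x) ≠ 0 := by
  rw [Ne, theta_eq_zero_iff hq hq1 (mul_ne_zero hc hx)]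
  rintro ⟨n, hn⟩
  refine h ⟨n, ?_⟩
  simp only
  rw [div_mul_eq_mul_div, div_eq_iff hc]
  linear_combination -hn

lemma theta_neg_q_mul_ne_zero {q x : ℂ} (hq : q ≠ 0) (hq1 : ‖q‖ < 1) (hx : x ≠ 0)
    (h : x ∉ spiral 1 q) : theta q (-q * x) ≠ 0 := by
  refine theta_mul_ne_zero_of_notMem_spiral hq hq1 (neg_ne_zero.2 hq) hx ?_
  rintro ⟨n, hn⟩
  refine h ⟨n - 1, ?_⟩
  simp only at hn ⊢
  rw [← hn, zpow_sub_one₀ hq, neg_div_neg_eq, one_div]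
  ring

lemma theta_div_ne_zero {q l x : ℂ} (hq : q ≠ 0) (hq1 : ‖q‖ < 1) (hl : l ≠ 0) (hx : x ≠ 0)
    (h : x ∉ spiral (-l) q) : theta q (l / x) ≠ 0 := by
  rw [Ne, theta_eq_zero_iff hq hq1 (div_ne_zero hl hx)]
  rintro ⟨n, hn⟩
  refine h ⟨-n, ?_⟩
  have hqn : q ^ n ≠ 0 := zpow_ne_zero n hq
  simp only
  rw [zpow_neg, ← div_eq_mul_inv, div_eq_iff hqn]
  rw [div_eq_iff hx] at hn
  linear_combination -hn

lemma qPochInf_div_mul_ne_zero {q a b x : ℂ} (hq1 : ‖q‖ < 1) (ha : a ≠ 0) (hb : b ≠ 0)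
    (hx : x ≠ 0) (h : ∀ n : ℕ, x ≠ q ^ (n + 1) / (a * b)) : qPochInf (q / (a * b * x)) q ≠ 0 := by
  rw [Ne, qPochInf_eq_zero_iff hq1]
  rintro ⟨k, hk⟩
  refine h k ?_
  rw [pow_succ]
  field_simp at hk ⊢
  linear_combination -hk

lemma eventually_qPochInf_div_ne_zero {q a b x : ℂ} (hq : q ≠ 0) (hq1 : ‖q‖ < 1) (ha : a ≠ 0)
    (hb : b ≠ 0) (hx : x ≠ 0) : ∀ᶠ y in 𝓝[≠] x, qPochInf (q / (a * b * y)) q ≠ 0 := by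
  have hab := mul_ne_zero ha hb
  refine eventually_ne_zero_of_differentiableOn (f := fun y => qPochInf (q / (a * b * y)) q)
    (x₁ := (a * b)⁻¹) (fun y hy => ?_) (inv_ne_zero hab) ?_ hx
  · have hy0 : a * b * y ≠ 0 := mul_ne_zero hab hy
    exact ((differentiable_qPochInf hq hq1 _).comp y
      (by fun_prop (disch := assumption))).differentiableWithinAt
  · rw [mul_inv_cancel₀ hab, div_one]
    exact qPochInf_self_ne_zero hq1

/-! ### The matrix identity -/

lemma f20_f21_eq_connMatrix_mulVec {a b q l m x : ℂ} (hq : q ≠ 0) (hq1 : ‖q‖ < 1) (ha : a ≠ 0)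
    (hb : b ≠ 0) (hab : ∀ n : ℤ, a * q ^ n ≠ b) (hl : l ≠ 0) (hθ : theta q l ≠ 0) (hx : x ≠ 0)
    (h0 : theta q (-q * x) ≠ 0) (h1 : theta q (m * x) ≠ 0) (h2 : theta q (a * m * x) ≠ 0)
    (h3 : theta q (b * m * x) ≠ 0) (hE : qPochInf (q / (a * b * x)) q ≠ 0) :
    ![f20 a b l q x, f21 a b q x] =
      (connMatrix l m a b q x).mulVec ![solInf m a b q x, solInf m b a q x] := by
  rw [f20_connection hq hq1 ha hb hab hl hθ hx h1 h2 h3 hE,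
    f21_connection hq hq1 ha hb hab hx h0 h1 h2 h3 hE]
  ext i
  fin_cases i <;> simp [connMatrix, Matrix.mulVec, dotProduct, Fin.sum_univ_two]

end QConfluent

open QConfluent

theorem mainTheorem2 (q a b l m : ℂ) (hq0 : 0 < ‖q‖) (hq1 : ‖q‖ < 1)
    (ha : a ≠ 0) (hb : b ≠ 0) (hab : a / b ∉ QConfluent.spiral 1 q)
    (hl : l ≠ 0) (hl' : l ∉ QConfluent.spiral (-1) q) (hm : m ≠ 0) :
    -- the meromorphic continuations that enter the functions below exist
    ((∃ F, QConfluent.IsMeroCont (QConfluent.qBorel q (QConfluent.basicHyp [a, b] [] q)) F) ∧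
      (∃ F, QConfluent.IsMeroCont (QConfluent.basicHyp [q / a, q / b] [0] q) F) ∧
      (∃ F, QConfluent.IsMeroCont (QConfluent.basicHyp [a, 0] [a * q / b] q) F) ∧
      (∃ F, QConfluent.IsMeroCont (QConfluent.basicHyp [b, 0] [b * q / a] q) F)) ∧
    -- the entries of the connection matrix are elliptic
    (∀ i j, QConfluent.IsQElliptic q fun x => QConfluent.connMatrix l m a b q x i j) ∧
    ∀ x : ℂ, x ≠ 0 → x ∉ QConfluent.spiral 1 q → x ∉ QConfluent.spiral (-l) q →
      -- the Laplace sum converges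
      Summable (fun n : ℤ =>
        QConfluent.meroCont (QConfluent.qBorel q (QConfluent.basicHyp [a, b] [] q)) (q ^ n * l) /
          QConfluent.theta q (q ^ n * l / x)) ∧
      -- the formula, with apparent singularities of the right side removed
      Tendsto
        (fun y => (QConfluent.connMatrix l m a b q y).mulVec
          ![QConfluent.solInf m a b q y, QConfluent.solInf m b a q y])
        (𝓝[≠] x) (𝓝 ![QConfluent.f20 a b l q x, QConfluent.f21 a b q x]) ∧
      -- the formula, pointwise wherever all the terms are defined
      (x ∉ QConfluent.spiral (-1 / m) q → x ∉ QConfluent.spiral (-1 / (a * m)) q →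
        x ∉ QConfluent.spiral (-1 / (b * m)) q → (∀ n : ℕ, x ≠ q ^ (n + 1) / (a * b)) →
        ![QConfluent.f20 a b l q x, QConfluent.f21 a b q x] =
          (QConfluent.connMatrix l m a b q x).mulVec
            ![QConfluent.solInf m a b q x, QConfluent.solInf m b a q x]) := by
  have hq : q ≠ 0 := norm_pos_iff.1 hq0
  have hab' : ∀ n : ℤ, a * q ^ n ≠ b := by
    intro n hn
    refine hab ⟨-n, ?_⟩
    have hqn : q ^ n ≠ 0 := zpow_ne_zero n hq
    simp only
    rw [← hn, zpow_neg]
    field_simp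
  have hba := mul_zpow_ne_symm hq hab'
  have hθ : theta q l ≠ 0 := by
    have h := theta_mul_ne_zero_of_notMem_spiral hq hq1 one_ne_zero hl (by rwa [div_one])
    rwa [one_mul] at h
  have ham := mul_ne_zero ha hm
  have hbm := mul_ne_zero hb hm
  refine ⟨⟨exists_isMeroCont_qBorel hq hq1 ha hb hab',
    exists_isMeroCont_phi hq hq1 (div_ne_zero hq ha) (div_ne_zero hq hb)
      (div_mul_zpow_ne hq ha hb hab'),
    exists_isMeroCont_conf hq hq1 ha (qPochInf_mul_div_ne_zero hq hq1 hb hab'),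
    exists_isMeroCont_conf hq hq1 hb (qPochInf_mul_div_ne_zero hq hq1 ha hba)⟩, ?_, ?_⟩
  · intro i j
    fin_cases i <;> fin_cases j
    · exact isQElliptic_coeffOne hq hq1 ha hl hm
    · exact isQElliptic_coeffOne hq hq1 hb hl hm
    · exact isQElliptic_coeffTwo hq hq1 ha hm
    · exact isQElliptic_coeffTwo hq hq1 hb hm
  · intro x hx hx1 hxl
    have h0 := theta_neg_q_mul_ne_zero hq hq1 hx hx1
    refine ⟨summable_laplace hq hq1 ha hb hab' hl hθ hx, ?_, fun h1 h2 h3 h4 => ?_⟩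
    -- the limit: the left side is continuous at `x`, and both sides agree near `x`
    · have hcont : ContinuousAt (fun y => ![f20 a b l q y, f21 a b q y]) x := by
        rw [continuousAt_pi, Fin.forall_fin_two]
        exact ⟨continuousAt_f20 hq hq1 ha hb hab' hl hθ hx (theta_div_ne_zero hq hq1 hl hx hxl),
          continuousAt_f21 hq hq1 ha hb hab' hx h0⟩
      refine (hcont.tendsto.mono_left nhdsWithin_le_nhds).congr' ?_
      filter_upwards [nhdsWithin_le_nhds (isOpen_ne.mem_nhds hx),
        eventually_theta_mul_ne_zero hq hq1 (neg_ne_zero.2 hq) hx,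
        eventually_theta_mul_ne_zero hq hq1 hm hx, eventually_theta_mul_ne_zero hq hq1 ham hx,
        eventually_theta_mul_ne_zero hq hq1 hbm hx,
        eventually_qPochInf_div_ne_zero hq hq1 ha hb hx] with y hy e0 e1 e2 e3 e4
      exact f20_f21_eq_connMatrix_mulVec hq hq1 ha hb hab' hl hθ hy e0 e1 e2 e3 e4
    · exact f20_f21_eq_connMatrix_mulVec hq hq1 ha hb hab' hl hθ hx h0
        (theta_mul_ne_zero_of_notMem_spiral hq hq1 hm hx h1)
        (theta_mul_ne_zero_of_notMem_spiral hq hq1 ham hx h2)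
        (theta_mul_ne_zero_of_notMem_spiral hq hq1 hbm hx h3)
        (qPochInf_div_mul_ne_zero hq1 ha hb hx h4)
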